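/- Let $k$ be a field and let $H$ be a group with a finite presentation $\langle S\mid R\rangle$ without free generators, i.e. $S$ and $R$ are finite and every generator $s\in S$ occurs (as $s$ or $s^{-1}$) in the reduced word of at least one relator $r\in R$. For $n\ge 0$ let $Q_n$ be the chain of $n$ triangles: the quiver with vertices $x_1,\dots,x_{n+1},y_1,\dots,y_n$ and arrows $r_i:x_i\to y_i$, $l_i:y_i\to x_{i+1}$, $a_i:x_i\to x_{i+1}$ $(1\le i\le n)$. Put $A_i=r_il_i$. In the path algebra $kQ_n$ (paths are composed from left to right) call $a_ia_{i+1}\cdots a_j+A_iA_{i+1}\cdots A_j$ $(i<j)$ a lasso and $a_i\,a_{i+1}\cdots a_{j-1}\,A_j+A_i\,a_{i+1}\cdots a_{j-1}\,a_j$ $(i<j)$ a cross-lasso. For a bound quiver $(Q,I)$, where $Q$ is a finite connected quiver and $I$ an admissible ideal ($F^m\subseteq I\subseteq F^2$ for some $m\ge2$, $F$ the ideal generated by the arrows), a minimal relation is an element $\sum_{i=1}^m\lambda_iw_i\in I$ with $m\ge 2$, $\lambda_i\in k^*$ and distinct parallel paths $w_i$, such that no partial sum over a nonempty proper subset of $\{1,\dots,m\}$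 lies in $I$. Homotopy of walks is the smallest equivalence relation compatible with concatenation such that $\alpha\alpha^{-1}$ and $\alpha^{-1}\alpha$ are homotopic to stationary walks for every arrow $\alpha$, and $w_i\sim w_j$ whenever $w_i,w_j$ occur in a common minimal relation; $\pi_1(Q,I)$ is the group of homotopy classes of closed walks at a base vertex (any choice of the vertex). A presentation of a $k$-algebra $A$ is a bound quiver $(Q,I)$ such that $I$ is the kernel of a surjective $k$-algebra morphism $kQ\to A$; $A$ is triangular if $Q$ has no oriented cycles. Then there are an $n\ge0$ and a presentation of $H$ with generators $w_1,\dots,w_n$ and finitely many relations, each of the form $w_iw_{i+1}\cdots w_j=1$ with $i<j$ or $w_i=w_j$ with $i<j$, where the index intervals $[i,j]$ of the relations of the first form partition $\{1,\dots,n\}$, such that the following holds. Let $Q_H=Q_n$, let $I\subseteq kQ_H$ be the ideal generated by the lassos $a_i\cdots a_j+A_i\cdots A_j$ of the relations $w_i\cdots w_j=1$ and the cross-lassos $a_ia_{i+1}\cdots a_{j-1}A_j+A_ia_{i+1}\cdots a_{j-1}a_j$ of the relations $w_i=w_j$, and let $\bar I=\varphi_n\circ\cdots\circ\varphi_1(I)$,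 where $\varphi_i$ is the automorphism (transvection) of $kQ_H$ with $\varphi_i(a_i)=a_i+A_i$ that fixes all stationary paths and all other arrows. Then $Q_H$ has no oriented cycles, $(Q_H,I)$ and $(Q_H,\bar I)$ are presentations of one and the same triangular algebra, $\pi_1(Q_H,I)\cong H$, and $\pi_1(Q_H,\bar I)$ is trivial. -/

import Mathlib

/-! ### Path algebras -/

/-- All paths of a quiver, together with their end points (the stationary paths are `Path.nil`). -/
abbrev AnyPath (V : Type*) [Quiver V] := Σ x y : V, Quiver.Path x y

/-- The path algebra `kQ`: the `k`-vector space whose basis is the set of paths of `Q`.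
(A new type, because `Finsupp` carries the pointwise product.) -/
def PathAlgebra (k : Type*) (V : Type*) [Quiver V] [Field k] := AnyPath V →₀ k

namespace PathAlgebra

section

variable {k V : Type*} [Field k] [Quiver V]

noncomputable instance : AddCommGroup (PathAlgebra k V) :=
  inferInstanceAs (AddCommGroup (AnyPath V →₀ k))

noncomputable instance : Module k (PathAlgebra k V) :=
  inferInstanceAs (Module k (AnyPath V →₀ k))

/-- The basis element given by a path. -/
noncomputable def ofAny (p : AnyPath V) : PathAlgebra k V := Finsupp.single p (1 : k)

variable (k) in
/-- The element of `kQ` given by a path `x → y`. -/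
noncomputable def ofPath {x y : V} (p : Quiver.Path x y) : PathAlgebra k V := ofAny ⟨x, y, p⟩

variable (k) in
/-- The element of `kQ` given by an arrow. -/
noncomputable def ofArrow {x y : V} (α : x ⟶ y) : PathAlgebra k V := ofPath k α.toPath

variable (k) in
/-- The stationary path `e_x`. -/
noncomputable def vertex (x : V) : PathAlgebra k V := ofPath k (Quiver.Path.nil : Quiver.Path x x)

open Classical in
/-- Product of two basis elements: the concatenation `p q` if `p` ends where `q` starts,
and `0` otherwise. -/
noncomputable def basisMul (p q : AnyPath V) : PathAlgebra k V :=
  if h : p.2.1 = q.1 then ofAny ⟨p.1, q.2.1, p.2.2.comp (q.2.2.cast h.symm rfl)⟩ else 0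

/-- The linear map with prescribed values on the paths. -/
noncomputable def liftLin {M : Type*} [AddCommGroup M] [Module k M] (f : AnyPath V → M) :
    PathAlgebra k V →ₗ[k] M := Finsupp.lift M k (AnyPath V) f

theorem liftLin_ofAny {M : Type*} [AddCommGroup M] [Module k M] (f : AnyPath V → M)
    (p : AnyPath V) : liftLin f (ofAny p : PathAlgebra k V) = f p := by
  have h : Finsupp.lift M k (AnyPath V) f (Finsupp.single p (1 : k)) = f p := by simp
  exact h

/-- The bilinear extension of `basisMul`. -/
noncomputable def mulLin : PathAlgebra k V →ₗ[k] PathAlgebra k V →ₗ[k] PathAlgebra k V :=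
  liftLin fun p => liftLin fun q => basisMul p q

noncomputable instance : Mul (PathAlgebra k V) := ⟨fun f g => mulLin f g⟩

theorem mul_def (f g : PathAlgebra k V) : f * g = mulLin f g := rfl

theorem ofAny_mul_ofAny (p q : AnyPath V) :
    (ofAny p * ofAny q : PathAlgebra k V) = basisMul p q := by
  rw [mul_def, mulLin, liftLin_ofAny, liftLin_ofAny]

theorem ofPath_mul_ofPath {x y z : V} (p : Quiver.Path x y) (q : Quiver.Path y z) :
    ofPath k p * ofPath k q = ofPath k (p.comp q) := by
  unfold ofPath
  rw [ofAny_mul_ofAny, basisMul, dif_pos rfl]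
  rfl

theorem ofPath_mul_ofPath_of_ne {x y y' z : V} (p : Quiver.Path x y) (q : Quiver.Path y' z)
    (h : y ≠ y') : ofPath k p * ofPath k q = 0 := by
  unfold ofPath
  rw [ofAny_mul_ofAny, basisMul, dif_neg h]

theorem induction_on {P : PathAlgebra k V → Prop} (f : PathAlgebra k V) (zero : P 0)
    (add : ∀ f g, P f → P g → P (f + g))
    (smul : ∀ (c : k) {x y : V} (p : Quiver.Path x y), P (c • ofPath k p)) : P f :=
  Finsupp.induction_linear f zero add fun p c => by
    have h : (Finsupp.single p c : AnyPath V →₀ k) = c • Finsupp.single p (1 : k) := by simp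
    rw [h]
    exact smul c p.2.2

theorem add_mul_aux (a b c : PathAlgebra k V) : (a + b) * c = a * c + b * c := by
  simp [mul_def]

theorem mul_add_aux (a b c : PathAlgebra k V) : a * (b + c) = a * b + a * c := by
  simp [mul_def]

theorem zero_mul_aux (a : PathAlgebra k V) : 0 * a = 0 := by simp [mul_def]

theorem mul_zero_aux (a : PathAlgebra k V) : a * 0 = 0 := by simp [mul_def]

theorem smul_mul_aux (r : k) (a b : PathAlgebra k V) : (r • a) * b = r • (a * b) := by
  simp [mul_def]

theorem mul_smul_aux (r : k) (a b : PathAlgebra k V) : a * (r • b) = r • (a * b) := by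
  simp [mul_def]

theorem mul_assoc_aux (a b c : PathAlgebra k V) : a * b * c = a * (b * c) := by
  induction a using induction_on with
  | zero => simp only [zero_mul_aux]
  | add f g hf hg => simp only [add_mul_aux, hf, hg]
  | smul r p =>
    simp only [smul_mul_aux]
    congr 1
    induction b using induction_on with
    | zero => simp only [zero_mul_aux, mul_zero_aux]
    | add f g hf hg => simp only [add_mul_aux, mul_add_aux, hf, hg]
    | smul s q =>
      simp only [smul_mul_aux, mul_smul_aux]
      congr 1
      induction c using induction_on with
      | zero => simp only [mul_zero_aux]
      | add f g hf hg => simp only [mul_add_aux, hf, hg]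
      | smul t w =>
        simp only [mul_smul_aux]
        congr 1
        rename_i x y x' y' x'' y''
        by_cases h : y = x'
        · subst h
          rw [ofPath_mul_ofPath]
          by_cases h' : y' = x''
          · subst h'
            simp only [ofPath_mul_ofPath, Quiver.Path.comp_assoc]
          · rw [ofPath_mul_ofPath_of_ne _ _ h', ofPath_mul_ofPath_of_ne _ _ h', mul_zero_aux]
        · rw [ofPath_mul_ofPath_of_ne _ _ h, zero_mul_aux]
          by_cases h' : y' = x''
          · subst h'
            rw [ofPath_mul_ofPath, ofPath_mul_ofPath_of_ne _ _ h]
          · rw [ofPath_mul_ofPath_of_ne _ _ h', mul_zero_aux]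

end

section

variable {k V : Type*} [Field k] [Quiver V] [Fintype V]

noncomputable instance : One (PathAlgebra k V) := ⟨∑ x : V, vertex k x⟩

theorem one_def : (1 : PathAlgebra k V) = ∑ x : V, vertex k x := rfl

theorem one_mul_aux (a : PathAlgebra k V) : 1 * a = a := by
  induction a using induction_on with
  | zero => rw [mul_zero_aux]
  | add f g hf hg => rw [mul_add_aux, hf, hg]
  | @smul c x y p =>
    rw [mul_smul_aux, one_def, mul_def, map_sum, LinearMap.sum_apply, Finset.sum_eq_single x]
    · rw [← mul_def, vertex, ofPath_mul_ofPath, Quiver.Path.nil_comp]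
    · intro z _ hz
      exact ofPath_mul_ofPath_of_ne _ _ hz
    · simp

theorem mul_one_aux (a : PathAlgebra k V) : a * 1 = a := by
  induction a using induction_on with
  | zero => rw [zero_mul_aux]
  | add f g hf hg => rw [add_mul_aux, hf, hg]
  | @smul c x y p =>
    rw [smul_mul_aux, one_def, mul_def, map_sum, Finset.sum_eq_single y]
    · rw [← mul_def, vertex, ofPath_mul_ofPath, Quiver.Path.comp_nil]
    · intro z _ hz
      exact ofPath_mul_ofPath_of_ne _ _ hz.symm
    · simp

noncomputable instance : Ring (PathAlgebra k V) :=
  { (inferInstance : AddCommGroup (PathAlgebra k V)),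
    (inferInstance : Mul (PathAlgebra k V)),
    (inferInstance : One (PathAlgebra k V)) with
    left_distrib := mul_add_aux
    right_distrib := add_mul_aux
    zero_mul := zero_mul_aux
    mul_zero := mul_zero_aux
    mul_assoc := mul_assoc_aux
    one_mul := one_mul_aux
    mul_one := mul_one_aux }

noncomputable instance : Algebra k (PathAlgebra k V) :=
  Algebra.ofModule smul_mul_aux mul_smul_aux

end

end PathAlgebra

/-! ### Bound quivers and presentations of algebras -/

section BoundQuiver

variable {k V : Type*} [Field k] [Quiver V] [Fintype V]

variable (k V) in
/-- The two-sided ideal `F` of `kQ` generated by the arrows. -/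
noncomputable def arrowIdeal : TwoSidedIdeal (PathAlgebra k V) :=
  TwoSidedIdeal.span {f | ∃ (x y : V) (α : x ⟶ y), f = PathAlgebra.ofArrow k α}

/-- `I` is admissible: `F ^ m ⊆ I ⊆ F ^ 2` for some `m ≥ 2`. -/
def IsAdmissible (I : TwoSidedIdeal (PathAlgebra k V)) : Prop :=
  ∃ m : ℕ, 2 ≤ m ∧ (arrowIdeal k V).asIdeal ^ m ≤ I.asIdeal ∧
    I.asIdeal ≤ (arrowIdeal k V).asIdeal ^ 2

end BoundQuiver

/-- Walks: paths in the quiver with formal inverses of all arrows adjoined. -/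
abbrev Walk {V : Type*} [Quiver V] (x y : Quiver.Symmetrify V) := Quiver.Path x y

/-- A path regarded as a walk. -/
def Quiver.Path.toWalk {V : Type*} [Quiver V] {x y : V} (p : Quiver.Path x y) :
    Walk (V := V) x y :=
  Quiver.Symmetrify.of.mapPath p

/-- The quiver is finite and connected. -/
structure IsFiniteConnectedQuiver (V : Type*) [Quiver V] : Prop where
  finite_vertices : Finite V
  finite_arrows : ∀ x y : V, Finite (x ⟶ y)
  nonempty : Nonempty V
  connected : ∀ x y : V, Nonempty (Walk (V := V) x y)

/-- The quiver has no oriented cycles. -/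
def IsAcyclicQuiver (V : Type*) [Quiver V] : Prop :=
  ∀ (x : V) (p : Quiver.Path x x), p = Quiver.Path.nil

/-- `(Q, I)` is a presentation of the `k`-algebra `A`: `Q` is finite and connected, `I` is
admissible and it is the kernel of a surjective morphism of `k`-algebras `kQ → A`. -/
structure IsPresentation {k V : Type*} [Field k] [Quiver V] [Fintype V]
    (I : TwoSidedIdeal (PathAlgebra k V)) (A : Type*) [Ring A] [Algebra k A] : Prop where
  quiver : IsFiniteConnectedQuiver V
  admissible : IsAdmissible I
  exists_map : ∃ ν : PathAlgebra k V →ₐ[k] A, Function.Surjective ν ∧ TwoSidedIdeal.ker ν = I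

/-- `A` is triangular: its quiver (which `A` determines up to isomorphism) has no oriented
cycles. -/
def IsTriangularAlgebra (k : Type*) [Field k] (A : Type*) [Ring A] [Algebra k A] : Prop :=
  ∃ (V : Type) (_ : Quiver.{0} V) (_ : Fintype V) (I : TwoSidedIdeal (PathAlgebra k V)),
    IsAcyclicQuiver V ∧ IsPresentation I A

/-! ### Homotopy and the fundamental group of a bound quiver -/

section Homotopy

variable {k V : Type*} [Field k] [Quiver V] [Fintype V]

/-- `∑ w ∈ S, c w • w`, a combination of distinct parallel paths with nonzero coefficients, is a
minimal relation of `I`: it lies in `I`, has at least two terms, and no nonempty proper part of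
the sum lies in `I`. -/
structure IsMinimalRelation (I : TwoSidedIdeal (PathAlgebra k V)) {x y : V}
    (S : Finset (Quiver.Path x y)) (c : Quiver.Path x y → k) : Prop where
  two_le : 2 ≤ S.card
  coeff_ne_zero : ∀ w ∈ S, c w ≠ 0
  mem : ∑ w ∈ S, c w • PathAlgebra.ofPath k w ∈ I
  not_mem : ∀ J : Finset (Quiver.Path x y), J ⊂ S → J.Nonempty →
    ∑ w ∈ J, c w • PathAlgebra.ofPath k w ∉ I

/-- The homotopy relation of `(Q, I)` on walks: the smallest equivalence relation, compatible with
concatenation, for which `α α⁻¹` and `α⁻¹ α` are homotopic to stationary walks and any two paths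
that occur in a common minimal relation are homotopic. -/
inductive Homotopic (I : TwoSidedIdeal (PathAlgebra k V)) :
    ∀ {x y : Quiver.Symmetrify V}, Walk x y → Walk x y → Prop
  | refl {x y : Quiver.Symmetrify V} (u : Walk x y) : Homotopic I u u
  | symm {x y : Quiver.Symmetrify V} {u v : Walk x y} : Homotopic I u v → Homotopic I v u
  | trans {x y : Quiver.Symmetrify V} {u v w : Walk x y} :
      Homotopic I u v → Homotopic I v w → Homotopic I u w
  | mul_inv {x y : V} (α : x ⟶ y) :
      Homotopic I
        ((Quiver.Hom.toPath (V := Quiver.Symmetrify V) (Quiver.Hom.toPos α)).comp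
          (Quiver.Hom.toPath (V := Quiver.Symmetrify V) (Quiver.Hom.toNeg α)))
        Quiver.Path.nil
  | inv_mul {x y : V} (α : x ⟶ y) :
      Homotopic I
        ((Quiver.Hom.toPath (V := Quiver.Symmetrify V) (Quiver.Hom.toNeg α)).comp
          (Quiver.Hom.toPath (V := Quiver.Symmetrify V) (Quiver.Hom.toPos α)))
        Quiver.Path.nil
  | minimal {x y : V} {S : Finset (Quiver.Path x y)} {c : Quiver.Path x y → k}
      (h : IsMinimalRelation I S c) {w w' : Quiver.Path x y} (hw : w ∈ S) (hw' : w' ∈ S) :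
      Homotopic I w.toWalk w'.toWalk
  | congr {x y z t : Quiver.Symmetrify V} (w : Walk x y) {u v : Walk y z} (w' : Walk z t) :
      Homotopic I u v → Homotopic I ((w.comp u).comp w') ((w.comp v).comp w')

/-- Homotopy of closed walks at `v₀`. -/
def homotopySetoid (I : TwoSidedIdeal (PathAlgebra k V)) (v₀ : Quiver.Symmetrify V) :
    Setoid (Walk v₀ v₀) where
  r := Homotopic I
  iseqv := ⟨Homotopic.refl, Homotopic.symm, Homotopic.trans⟩

/-- The fundamental group `π₁(Q, I, v₀)`: homotopy classes of closed walks at `v₀`. -/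
def FundamentalGroupBQ (I : TwoSidedIdeal (PathAlgebra k V)) (v₀ : V) : Type _ :=
  Quotient (homotopySetoid I v₀)

variable {I : TwoSidedIdeal (PathAlgebra k V)}

theorem Homotopic.comp {x y z : Quiver.Symmetrify V} {u u' : Walk x y} {v v' : Walk y z}
    (hu : Homotopic I u u') (hv : Homotopic I v v') :
    Homotopic I (u.comp v) (u'.comp v') := by
  have h1 := Homotopic.congr Quiver.Path.nil v hu
  have h2 := Homotopic.congr u' Quiver.Path.nil hv
  rw [Quiver.Path.nil_comp, Quiver.Path.nil_comp] at h1
  rw [Quiver.Path.comp_nil, Quiver.Path.comp_nil] at h2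
  exact h1.trans h2

theorem Homotopic.hom_comp_reverse {x y : Quiver.Symmetrify V} (α : x ⟶ y) :
    Homotopic I (α.toPath.comp (Quiver.reverse α).toPath) Quiver.Path.nil := by
  rcases α with α | α
  · exact Homotopic.mul_inv α
  · exact Homotopic.inv_mul α

theorem Homotopic.comp_reverse {x y : Quiver.Symmetrify V} (u : Walk x y) :
    Homotopic I (u.comp u.reverse) Quiver.Path.nil := by
  induction u with
  | nil => exact Homotopic.refl _
  | cons p α ih =>
    have h := Homotopic.congr (I := I) p p.reverse (Homotopic.hom_comp_reverse α)
    rw [Quiver.Path.comp_nil] at h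
    refine Homotopic.trans ?_ (h.trans ih)
    have e : (p.cons α).comp (p.cons α).reverse =
        (p.comp (α.toPath.comp (Quiver.reverse α).toPath)).comp p.reverse := by
      rw [Quiver.Path.reverse, ← Quiver.Path.comp_toPath_eq_cons]
      simp only [Quiver.Path.comp_assoc]
    rw [e]
    exact Homotopic.refl _

theorem Homotopic.reverse_comp {x y : Quiver.Symmetrify V} (u : Walk x y) :
    Homotopic I (u.reverse.comp u) Quiver.Path.nil := by
  have h := Homotopic.comp_reverse (I := I) u.reverse
  rwa [Quiver.Path.reverse_reverse] at h

theorem Homotopic.reverse {x y : Quiver.Symmetrify V} {u v : Walk x y} (h : Homotopic I u v) :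
    Homotopic I u.reverse v.reverse := by
  have h1 := Homotopic.congr u.reverse v.reverse h
  have h2 := Homotopic.comp (Homotopic.reverse_comp (I := I) u) (Homotopic.refl v.reverse)
  have h3 := Homotopic.comp (Homotopic.refl u.reverse) (Homotopic.comp_reverse (I := I) v)
  rw [Quiver.Path.nil_comp] at h2
  rw [Quiver.Path.comp_nil, ← Quiver.Path.comp_assoc] at h3
  exact h3.symm.trans (h1.symm.trans h2)

/-- The product is induced by the concatenation of walks. -/
instance (v₀ : V) : Group (FundamentalGroupBQ I v₀) where
  mul := Quotient.map₂ (fun u v => u.comp v) fun _ _ hu _ _ hv => Homotopic.comp hu hv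
  one := Quotient.mk _ Quiver.Path.nil
  inv := Quotient.map (fun u => u.reverse) fun _ _ h => Homotopic.reverse h
  mul_assoc := by
    rintro ⟨u⟩ ⟨v⟩ ⟨w⟩
    exact congrArg (Quotient.mk _) (Quiver.Path.comp_assoc u v w)
  one_mul := by
    rintro ⟨u⟩
    exact congrArg (Quotient.mk _) (Quiver.Path.nil_comp u)
  mul_one := by
    rintro ⟨u⟩
    exact congrArg (Quotient.mk _) (Quiver.Path.comp_nil u)
  inv_mul_cancel := by
    rintro ⟨u⟩
    exact Quotient.sound (Homotopic.reverse_comp u)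

end Homotopy

/-! ### Transvections -/

/-- `φ` is the transvection of `kQ` which sends the arrow `β` to `β + c • ρ`, where `c ≠ 0` and
`ρ` is a path of length at least two parallel to `β`, and which fixes all stationary paths and
all other arrows. -/
structure IsTransvection {k V : Type*} [Field k] [Quiver V] [Fintype V]
    (φ : PathAlgebra k V ≃ₐ[k] PathAlgebra k V) {x y : V} (β : x ⟶ y) (c : k)
    (ρ : Quiver.Path x y) : Prop where
  coeff_ne_zero : c ≠ 0
  two_le_length : 2 ≤ ρ.length
  map_vertex : ∀ z : V, φ (PathAlgebra.vertex k z) = PathAlgebra.vertex k z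
  map_arrow : φ (PathAlgebra.ofArrow k β) = PathAlgebra.ofArrow k β + c • PathAlgebra.ofPath k ρ
  map_other : ∀ (z t : V) (α : z ⟶ t),
    (⟨z, t, α⟩ : Σ z t : V, (z ⟶ t)) ≠ ⟨x, y, β⟩ →
      φ (PathAlgebra.ofArrow k α) = PathAlgebra.ofArrow k α

/-! ### The chain of `n` triangles -/

/-- The vertices `x_0, …, x_n` and `y_0, …, y_{n-1}`. -/
inductive ChainVertex (n : ℕ) : Type
  | x (i : Fin (n + 1)) : ChainVertex n
  | y (i : Fin n) : ChainVertex n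

/-- The arrows `r_i : x_i → y_i`, `l_i : y_i → x_{i+1}` and `a_i : x_i → x_{i+1}`. -/
inductive ChainArrow (n : ℕ) : ChainVertex n → ChainVertex n → Type
  | r (i : Fin n) : ChainArrow n (.x i.castSucc) (.y i)
  | l (i : Fin n) : ChainArrow n (.y i) (.x i.succ)
  | a (i : Fin n) : ChainArrow n (.x i.castSucc) (.x i.succ)

instance (n : ℕ) : Quiver.{0} (ChainVertex n) := ⟨ChainArrow n⟩

instance (n : ℕ) : Fintype (ChainVertex n) :=
  Fintype.ofEquiv (Fin (n + 1) ⊕ Fin n)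
    { toFun := Sum.elim .x .y
      invFun := fun v => match v with
        | .x i => .inl i
        | .y i => .inr i
      left_inv := by rintro (i | i) <;> rfl
      right_inv := by rintro (i | i) <;> rfl }

namespace Chain

variable {n : ℕ}

/-- The arrow `a_i`. -/
def arrowA (i : Fin n) : (ChainVertex.x i.castSucc : ChainVertex n) ⟶ ChainVertex.x i.succ :=
  ChainArrow.a i

/-- The path `A_i = r_i l_i`. -/
def pathA (i : Fin n) :
    Quiver.Path (ChainVertex.x i.castSucc : ChainVertex n) (ChainVertex.x i.succ) :=
  (Quiver.Hom.toPath (V := ChainVertex n) (ChainArrow.r i)).comp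
    (Quiver.Hom.toPath (V := ChainVertex n) (ChainArrow.l i))

/-- The indices `i, i + 1, …, j` in increasing order. -/
def block (i j : Fin n) : List (Fin n) := (List.finRange n).filter fun t => i ≤ t ∧ t ≤ j

/-- The indices `i + 1, …, j - 1` in increasing order. -/
def between (i j : Fin n) : List (Fin n) := (List.finRange n).filter fun t => i < t ∧ t < j

variable (k : Type*) [Field k]

/-- `a_i` as an element of the path algebra. -/
noncomputable def a (i : Fin n) : PathAlgebra k (ChainVertex n) :=
  PathAlgebra.ofArrow k (arrowA i)

/-- `A_i` as an element of the path algebra. -/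
noncomputable def A (i : Fin n) : PathAlgebra k (ChainVertex n) :=
  PathAlgebra.ofPath k (pathA i)

/-- The lasso `a_i a_{i+1} ⋯ a_j + A_i A_{i+1} ⋯ A_j`. -/
noncomputable def lasso (i j : Fin n) : PathAlgebra k (ChainVertex n) :=
  ((block i j).map (a k)).prod + ((block i j).map (A k)).prod

/-- The cross-lasso `a_i m A_j + A_i m a_j`, where `m = a_{i+1} ⋯ a_{j-1}`. -/
noncomputable def crossLasso (i j : Fin n) : PathAlgebra k (ChainVertex n) :=
  a k i * ((between i j).map (a k)).prod * A k j +
    A k i * ((between i j).map (a k)).prod * a k j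

end Chain

/-- The combinatorial data of a presentation of a group with generators `w_0, …, w_{n-1}` and
relations of two types: `w_i w_{i+1} ⋯ w_j = 1` for `(i, j) ∈ lassos`, and `w_i = w_j` for
`(i, j) ∈ crosses`. The lassos cut the list of generators into consecutive blocks, each of length
at least two. -/
structure LassoData (n : ℕ) where
  lassos : Finset (Fin n × Fin n)
  crosses : Finset (Fin n × Fin n)
  lassos_lt : ∀ p ∈ lassos, p.1 < p.2
  crosses_lt : ∀ p ∈ crosses, p.1 < p.2
  partition : ∀ t : Fin n, ∃! p : Fin n × Fin n, p ∈ lassos ∧ p.1 ≤ t ∧ t ≤ p.2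

namespace LassoData

variable {n : ℕ} (L : LassoData n)

/-- The relators of the group presentation. -/
def relators : Set (FreeGroup (Fin n)) :=
  {r | ∃ p ∈ L.lassos, r = ((Chain.block p.1 p.2).map FreeGroup.of).prod} ∪
    {r | ∃ p ∈ L.crosses, r = FreeGroup.of p.1 * (FreeGroup.of p.2)⁻¹}

/-- The ideal of the path algebra of the chain of triangles generated by the lassos and
cross-lassos that correspond to the relations. -/
noncomputable def ideal (k : Type*) [Field k] : TwoSidedIdeal (PathAlgebra k (ChainVertex n)) :=
  TwoSidedIdeal.span
    ({f | ∃ p ∈ L.lassos, f = Chain.lasso k p.1 p.2} ∪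
      {f | ∃ p ∈ L.crosses, f = Chain.crossLasso k p.1 p.2})

end LassoData

/-! ### Free generators -/

/-- `s` is a free generator of the presentation `⟨S | R⟩`: it occurs in no relator. -/
def IsFreeGenerator {S : Type*} [DecidableEq S] (R : Set (FreeGroup S)) (s : S) : Prop :=
  ∀ r ∈ R, ∀ b : Bool, (s, b) ∉ r.toWord

universe u

/-! ### Coefficients and supports in the path algebra -/

namespace PathAlgebra

section

variable {k V : Type*} [Field k] [Quiver V]

/-! The arrows $a_t$ and $r_t$ form a spanning tree of $Q_n$, so for every ideal $\pi_1$ is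
generated by the classes $w_t$ of the arrows $l_t$. A path from $x_i$ to $x_{j+1}$ is a word that
chooses $a_t$ or $A_t$ for each $t\in[i,j]$, and its weight is the product of the $w_t$ with $A_t$
chosen. A homotopy between the two paths of a lasso therefore says $w_i\cdots w_j=1$, and one
between the two paths of a cross-lasso says $w_i=w_j$.

No other relations hold for $I$. Give paths their weight in the group presented by the relators. The
generators of $I$ are sums of two paths of equal weight, so $I$ is graded by weight and a minimal
relation cannot mix weights (`Homotopic.walkWeight_eq`). Conversely, if $u+v\in I$ and $u\notin I$,
then $u+v$ is a minimal relation (`Homotopic.of_add_mem`). That the paths in question are not in $I$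
is seen from a character: scalars $\mu_t\neq0$ with $\mu_i\cdots\mu_j=-1$ on each lasso and
$\mu_i+\mu_j=0$ on each cross-lasso. The functional $a_t\mapsto1$, $A_t\mapsto\mu_t$ on paths kills
$I$ and is nonzero on these paths (`LassoData.ofPath_notMem_ideal`).

The transvections turn a lasso into $\prod(a_t+A_t)+\prod A_t$. Every word of the block occurs in it
with coefficient $1$, except that $A_i\cdots A_j$ has coefficient $2$. If no cross-lasso lies inside
a block, the lasso spans the part of $I$ between the end points of the block, so its image is, up to
scalars, the only relation there and hence minimal. It makes $a_i\cdots A_t\cdots a_j$ homotopic to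
$a_i\cdots a_j$, that is, $w_t=1$ for all $t$ (`LassoData.subsingleton_fundamentalGroup_sheared`).

It remains to choose the presentation. Each $s\in S$ gets a source block with letters $s,s^{-1}$;
each nontrivial relator gets a block that spells it. Cross-lassos join a letter of a source block to
every equal letter of a relator block, hence never lie inside one block. For the character, $s$ and
$s^{-1}$ get $-1$ and $1$ in relator blocks and the opposite signs in source blocks. Source blocks
then have product $-1$, and a relator word is corrected by appending $ss^{-1}$, which changes the
sign of the product but not the element (`LassoData.exists_word`). -/

theorem ofPath_eq_ofAny {x y : V} (p : Quiver.Path x y) : ofPath k p = ofAny ⟨x, y, p⟩ := rfl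

theorem liftLin_ofPath {M : Type*} [AddCommGroup M] [Module k M] (f : AnyPath V → M)
    {x y : V} (p : Quiver.Path x y) : liftLin f (ofPath k p) = f ⟨x, y, p⟩ :=
  liftLin_ofAny f _

theorem linearMap_ext {M : Type*} [AddCommGroup M] [Module k M] {f g : PathAlgebra k V →ₗ[k] M}
    (h : ∀ {x y : V} (p : Quiver.Path x y), f (ofPath k p) = g (ofPath k p)) : f = g := by
  ext a
  induction a using induction_on with
  | zero => simp
  | add a b ha hb => rw [map_add, map_add, ha, hb]
  | smul c p => rw [map_smul, map_smul, h]

/-- The coefficient of a path. -/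
noncomputable def coeff (p : AnyPath V) : PathAlgebra k V →ₗ[k] k :=
  (Finsupp.lapply p : (AnyPath V →₀ k) →ₗ[k] k)

open Classical in
theorem coeff_ofAny (p q : AnyPath V) :
    coeff p (ofAny q : PathAlgebra k V) = if q = p then 1 else 0 :=
  Finsupp.single_apply

theorem coeff_ofAny_self (p : AnyPath V) : coeff p (ofAny p : PathAlgebra k V) = 1 := by
  rw [coeff_ofAny, if_pos rfl]

theorem coeff_ofAny_of_ne {p q : AnyPath V} (h : q ≠ p) :
    coeff p (ofAny q : PathAlgebra k V) = 0 := by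
  rw [coeff_ofAny, if_neg h]

theorem mul_vertex {x y : V} (p : Quiver.Path x y) :
    ofPath k p * vertex k y = ofPath k p := by
  rw [vertex, ofPath_mul_ofPath, Quiver.Path.comp_nil]

theorem vertex_mul {x y : V} (p : Quiver.Path x y) :
    vertex k x * ofPath k p = ofPath k p := by
  rw [vertex, ofPath_mul_ofPath, Quiver.Path.nil_comp]

theorem vertex_mul_vertex (x : V) : vertex k x * vertex k x = vertex k x := vertex_mul _

theorem vertex_mul_vertex_of_ne (x y : V) (h : x ≠ y) : vertex k x * vertex k y = 0 :=
  ofPath_mul_ofPath_of_ne _ _ h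

theorem ofPath_cons {x y z : V} (p : Quiver.Path x y) (α : y ⟶ z) :
    ofPath k (p.cons α) = ofPath k p * ofArrow k α := by
  rw [ofArrow, ofPath_mul_ofPath]; rfl

/-- Appending a fixed arrow is injective on paths. With the next lemma this reads off coefficients
of a product of arrows from the right, one arrow at a time. -/
theorem coeff_mul_ofArrow {x y z : V} (f : PathAlgebra k V) (p : Quiver.Path x y) (α : y ⟶ z) :
    coeff ⟨x, z, p.cons α⟩ (f * ofArrow k α) = coeff ⟨x, y, p⟩ f := by
  induction f using induction_on with
  | zero => rw [zero_mul_aux, map_zero, map_zero]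
  | add f g hf hg => rw [add_mul_aux, map_add, map_add, hf, hg]
  | @smul c x' y' q =>
    rw [smul_mul_aux, map_smul, map_smul]
    congr 1
    by_cases h : y' = y
    · subst h
      rw [← ofPath_cons, ofPath_eq_ofAny, ofPath_eq_ofAny, coeff_ofAny, coeff_ofAny]
      congr 1
      apply propext
      constructor
      · intro e
        obtain ⟨rfl, e⟩ := Sigma.mk.inj_iff.1 e
        have e := (Sigma.mk.inj_iff.1 (eq_of_heq e)).2
        have e := (Quiver.Path.cons.inj (eq_of_heq e)).2.1
        rw [eq_of_heq e]
      · intro e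
        obtain ⟨rfl, e⟩ := Sigma.mk.inj_iff.1 e
        have e := (Sigma.mk.inj_iff.1 (eq_of_heq e)).2
        rw [eq_of_heq e]
    · rw [ofArrow, ofPath_mul_ofPath_of_ne _ _ h, map_zero, ofPath_eq_ofAny, coeff_ofAny_of_ne]
      rintro e
      obtain ⟨rfl, e⟩ := Sigma.mk.inj_iff.1 e
      exact h (Sigma.mk.inj_iff.1 (eq_of_heq e)).1

/-- The last arrows start at different vertices. This separates $a_t$ from $A_t$, whose last arrows
both end at $x_{t+1}$. -/
theorem coeff_mul_ofArrow_of_ne {x y y' z : V} (f : PathAlgebra k V) (p : Quiver.Path x y)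
    (α : y ⟶ z) (β : y' ⟶ z) (h : y' ≠ y) :
    coeff ⟨x, z, p.cons α⟩ (f * ofArrow k β) = 0 := by
  induction f using induction_on with
  | zero => rw [zero_mul_aux, map_zero]
  | add f g hf hg => rw [add_mul_aux, map_add, hf, hg, add_zero]
  | @smul c x' y'' q =>
    rw [smul_mul_aux, map_smul]
    by_cases h' : y'' = y'
    · subst h'
      rw [← ofPath_cons, ofPath_eq_ofAny, coeff_ofAny_of_ne, smul_zero]
      intro e
      obtain ⟨rfl, e⟩ := Sigma.mk.inj_iff.1 e
      have e := (Sigma.mk.inj_iff.1 (eq_of_heq e)).2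
      exact h (Quiver.Path.cons.inj (eq_of_heq e)).1
    · rw [ofArrow, ofPath_mul_ofPath_of_ne _ _ h', map_zero, smul_zero]

open Classical in
theorem vertex_mul_ofAny_mul_vertex (x y : V) (p : AnyPath V) :
    vertex k x * ofAny p * vertex k y =
      if p ∈ Set.range (fun w : Quiver.Path x y => (⟨x, y, w⟩ : AnyPath V)) then ofAny p else 0 := by
  obtain ⟨x', y', p⟩ := p
  by_cases hx : x = x'
  · subst hx
    by_cases hy : y' = y
    · subst hy
      rw [if_pos ⟨p, rfl⟩, ← ofPath_eq_ofAny, vertex_mul, mul_vertex]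
    · rw [if_neg, ← ofPath_eq_ofAny, vertex_mul, vertex, ofPath_mul_ofPath_of_ne _ _ hy]
      rintro ⟨w, e⟩
      obtain ⟨-, e⟩ := Sigma.mk.inj_iff.1 e
      exact hy (Sigma.mk.inj_iff.1 (eq_of_heq e)).1.symm
  · rw [if_neg, ← ofPath_eq_ofAny, vertex, ofPath_mul_ofPath_of_ne _ _ hx, zero_mul_aux]
    rintro ⟨w, e⟩
    exact hx (Sigma.mk.inj_iff.1 e).1

theorem anyPath_injective (x y : V) :
    Function.Injective (fun w : Quiver.Path x y => (⟨x, y, w⟩ : AnyPath V)) := by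
  intro w w' e
  have e := (Sigma.mk.inj_iff.1 e).2
  exact eq_of_heq (Sigma.mk.inj_iff.1 (eq_of_heq e)).2

/-- The paths from `x` to `y` which occur in an element of the path algebra. -/
noncomputable def pathSupport (f : PathAlgebra k V) (x y : V) : Finset (Quiver.Path x y) :=
  Finset.preimage (Finsupp.support (f : AnyPath V →₀ k)) (fun w => (⟨x, y, w⟩ : AnyPath V))
    (anyPath_injective x y).injOn

theorem mem_pathSupport {f : PathAlgebra k V} {x y : V} {w : Quiver.Path x y} :
    w ∈ pathSupport f x y ↔ coeff ⟨x, y, w⟩ f ≠ 0 := by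
  rw [pathSupport, Finset.mem_preimage]
  exact Finsupp.mem_support_iff (f := (f : AnyPath V →₀ k))

/-- Puts the component $e_xfe_y$ into the shape that `IsMinimalRelation` asks for. -/
theorem sum_pathSupport (f : PathAlgebra k V) (x y : V) :
    ∑ w ∈ pathSupport f x y, coeff ⟨x, y, w⟩ f • ofPath k w = vertex k x * f * vertex k y := by
  classical
  have h1 : f = ∑ p ∈ Finsupp.support (f : AnyPath V →₀ k), coeff p f • ofAny p := by
    have h := Finsupp.sum_single (f : AnyPath V →₀ k)
    refine h.symm.trans (Finset.sum_congr rfl fun p _ => ?_)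
    have h2 : ∀ c : k, (Finsupp.single p c : AnyPath V →₀ k) = c • Finsupp.single p (1 : k) := by
      simp
    exact h2 _
  have h2 : vertex k x * f * vertex k y = ∑ p ∈ Finsupp.support (f : AnyPath V →₀ k),
      coeff p f • (vertex k x * ofAny p * vertex k y) := by
    have key : ∀ g : PathAlgebra k V, vertex k x * g * vertex k y =
        ((mulLin (k := k)).flip (vertex k y) ∘ₗ mulLin (vertex k x)) g := fun g => rfl
    rw [key]
    conv_lhs => rw [h1]
    rw [map_sum]
    refine Finset.sum_congr rfl fun p _ => ?_
    rw [map_smul, ← key]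
  rw [h2, pathSupport, Finset.sum_preimage (fun w : Quiver.Path x y => (⟨x, y, w⟩ : AnyPath V)) _
    (anyPath_injective x y).injOn
    (fun p => coeff p f • (vertex k x * ofAny p * vertex k y)) ?_ |>.symm]
  · refine Finset.sum_congr rfl fun w _ => ?_
    rw [vertex_mul_ofAny_mul_vertex, if_pos ⟨w, rfl⟩, ofPath_eq_ofAny]
  · intro p _ hp
    rw [vertex_mul_ofAny_mul_vertex, if_neg hp, smul_zero]

end

/-! ### Ideals, the universal property and admissibility -/

section

variable {k V : Type*} [Field k] [Quiver V] [Fintype V]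

/-- A two-sided ideal is spanned by the products of its generators with paths on both sides. -/
theorem mem_of_mem_span {s : Set (PathAlgebra k V)} {f : PathAlgebra k V}
    (hf : f ∈ TwoSidedIdeal.span s) (P : Submodule k (PathAlgebra k V))
    (h : ∀ g ∈ s, ∀ {x y z t : V} (p : Quiver.Path x y) (q : Quiver.Path z t),
      ofPath k p * g * ofPath k q ∈ P) : f ∈ P := by
  have key : ∀ g ∈ s, ∀ a b : PathAlgebra k V, a * g * b ∈ P := by
    intro g hg a b
    induction a using induction_on with
    | zero => simp
    | add a a' ha ha' => rw [add_mul, add_mul]; exact P.add_mem ha ha'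
    | smul c p =>
      rw [smul_mul_assoc, smul_mul_assoc]
      refine P.smul_mem _ ?_
      induction b using induction_on with
      | zero => simp
      | add b b' hb hb' => rw [mul_add]; exact P.add_mem hb hb'
      | smul c q =>
        rw [mul_smul_comm]
        exact P.smul_mem _ (h g hg p q)
  rw [TwoSidedIdeal.mem_span_iff_mem_addSubgroup_closure] at hf
  induction hf using AddSubgroup.closure_induction with
  | mem x hx =>
    obtain ⟨a, ha, b, -, rfl⟩ := hx
    obtain ⟨c, -, g, hg, rfl⟩ := ha
    exact key g hg c b
  | zero => exact P.zero_mem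
  | add x y _ _ hx hy => exact P.add_mem hx hy
  | neg x _ hx => exact P.neg_mem hx

theorem smul_mem_twoSidedIdeal {I : TwoSidedIdeal (PathAlgebra k V)} (c : k)
    {f : PathAlgebra k V} (hf : f ∈ I) : c • f ∈ I := by
  have h : c • f = (c • (1 : PathAlgebra k V)) * f := by rw [smul_mul_assoc, one_mul]
  rw [h]
  exact I.mul_mem_left _ _ hf

/-- A two-sided ideal as a subspace. -/
noncomputable def idealSubmodule (I : TwoSidedIdeal (PathAlgebra k V)) :
    Submodule k (PathAlgebra k V) where
  carrier := I
  add_mem' ha hb := I.add_mem ha hb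
  zero_mem' := I.zero_mem
  smul_mem' c _ hf := smul_mem_twoSidedIdeal c hf

/-- A linear map which is multiplicative on paths is multiplicative. -/
theorem map_mul_of_paths {B : Type*} [Ring B] [Algebra k B] (L : PathAlgebra k V →ₗ[k] B)
    (h : ∀ {x y z t : V} (p : Quiver.Path x y) (q : Quiver.Path z t),
      L (ofPath k p * ofPath k q) = L (ofPath k p) * L (ofPath k q))
    (a b : PathAlgebra k V) : L (a * b) = L a * L b := by
  induction a using induction_on with
  | zero => simp
  | add a a' ha ha' => rw [add_mul, map_add, map_add, add_mul, ha, ha']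
  | smul c p =>
    rw [smul_mul_assoc, map_smul, map_smul, smul_mul_assoc]
    congr 1
    induction b using induction_on with
    | zero => simp
    | add b b' hb hb' => rw [mul_add, map_add, map_add, mul_add, hb, hb']
    | smul c q => rw [mul_smul_comm, map_smul, map_smul, mul_smul_comm, h]

/-- The universal property of the path algebra. -/
noncomputable def lift {B : Type*} [Ring B] [Algebra k B] (e : V → B)
    (f : ∀ {x y : V}, (x ⟶ y) → B) (he : ∀ x, e x * e x = e x)
    (he' : ∀ x y, x ≠ y → e x * e y = 0) (hone : ∑ x, e x = 1)
    (hr : ∀ {x y : V} (α : x ⟶ y), f α * e y = f α) : PathAlgebra k V →ₐ[k] B :=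
  -- The factor `e p.1` is there for the stationary paths: they have weight `1` but must go to
  -- idempotents.
  AlgHom.ofLinearMap (liftLin fun p : AnyPath V => e p.1 * Quiver.Path.weight f p.2.2)
    (by
      rw [one_def, map_sum, ← hone]
      refine Finset.sum_congr rfl fun x _ => ?_
      rw [vertex, liftLin_ofPath, Quiver.Path.weight_nil, mul_one])
    (by
      refine map_mul_of_paths _ ?_
      intro x y z t p q
      -- The value of a path absorbs the idempotent of its end point, so values of non-composable
      -- paths multiply to `0` by orthogonality.
      have hp : e x * Quiver.Path.weight f p * e y = e x * Quiver.Path.weight f p := by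
        cases p with
        | nil => rw [Quiver.Path.weight_nil, mul_one, he]
        | cons p α => rw [Quiver.Path.weight_cons, mul_assoc, mul_assoc, hr]
      by_cases h : y = z
      · subst h
        rw [ofPath_mul_ofPath, liftLin_ofPath, liftLin_ofPath, liftLin_ofPath,
          Quiver.Path.weight_comp, ← mul_assoc, ← mul_assoc, hp]
      · rw [ofPath_mul_ofPath_of_ne _ _ h, map_zero, liftLin_ofPath, liftLin_ofPath]
        change 0 = e x * Quiver.Path.weight f p * (e z * Quiver.Path.weight f q)
        rw [← hp, mul_assoc _ (e y), ← mul_assoc (e y), he' y z h, zero_mul, mul_zero])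

section lift

variable {B : Type*} [Ring B] [Algebra k B] (e : V → B)
    (f : ∀ {x y : V}, (x ⟶ y) → B) (he : ∀ x, e x * e x = e x)
    (he' : ∀ x y, x ≠ y → e x * e y = 0) (hone : ∑ x, e x = 1)
    (hr : ∀ {x y : V} (α : x ⟶ y), f α * e y = f α)

theorem lift_vertex (x : V) : lift e f he he' hone hr (vertex k x) = e x := by
  change liftLin _ (ofPath k _) = _
  rw [liftLin_ofPath, Quiver.Path.weight_nil, mul_one]

theorem lift_ofArrow (hl : ∀ {x y : V} (α : x ⟶ y), e x * f α = f α) {x y : V} (α : x ⟶ y) :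
    lift e f he he' hone hr (ofArrow k α) = f α := by
  change liftLin _ (ofPath k _) = _
  rw [liftLin_ofPath, Quiver.Hom.toPath, Quiver.Path.weight_cons, Quiver.Path.weight_nil, one_mul,
    hl]

end lift

theorem algHom_ext {B : Type*} [Ring B] [Algebra k B] {F G : PathAlgebra k V →ₐ[k] B}
    (hv : ∀ x, F (vertex k x) = G (vertex k x))
    (ha : ∀ {x y : V} (α : x ⟶ y), F (ofArrow k α) = G (ofArrow k α)) : F = G := by
  have h : F.toLinearMap = G.toLinearMap := by
    refine linearMap_ext fun {x y} p => ?_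
    change F (ofPath k p) = G (ofPath k p)
    induction p with
    | nil => exact hv x
    | cons p α ih => rw [ofPath_cons, map_mul, map_mul, ih, ha]
  exact AlgHom.toLinearMap_injective h

/-- The endomorphism of the path algebra which fixes the stationary paths and has prescribed
values on the arrows. -/
noncomputable def arrowMap (f : ∀ {x y : V}, (x ⟶ y) → PathAlgebra k V)
    (hr : ∀ {x y : V} (α : x ⟶ y), f α * vertex k y = f α) : PathAlgebra k V →ₐ[k] PathAlgebra k V :=
  lift (vertex k) f vertex_mul_vertex vertex_mul_vertex_of_ne one_def.symm hr

/-! #### The filtration by length of paths -/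

variable (k V) in
/-- The span of the paths of length at least `m`. -/
noncomputable def lengthFiltration (m : ℕ) : Submodule k (PathAlgebra k V) :=
  Submodule.span k {f | ∃ (x y : V) (p : Quiver.Path x y), m ≤ p.length ∧ f = ofPath k p}

theorem ofPath_mem_lengthFiltration {m : ℕ} {x y : V} (p : Quiver.Path x y) (h : m ≤ p.length) :
    ofPath k p ∈ lengthFiltration k V m :=
  Submodule.subset_span ⟨x, y, p, h, rfl⟩

theorem mul_mem_lengthFiltration {m m' : ℕ} {f g : PathAlgebra k V}
    (hf : f ∈ lengthFiltration k V m) (hg : g ∈ lengthFiltration k V m') :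
    f * g ∈ lengthFiltration k V (m + m') := by
  induction hf using Submodule.span_induction with
  | zero => rw [zero_mul]; exact Submodule.zero_mem _
  | add a b _ _ ha hb => rw [add_mul]; exact Submodule.add_mem _ ha hb
  | smul c a _ ha => rw [smul_mul_assoc]; exact Submodule.smul_mem _ _ ha
  | mem a ha =>
    obtain ⟨x, y, p, hp, rfl⟩ := ha
    induction hg using Submodule.span_induction with
    | zero => rw [mul_zero]; exact Submodule.zero_mem _
    | add a b _ _ ha hb => rw [mul_add]; exact Submodule.add_mem _ ha hb
    | smul c a _ ha => rw [mul_smul_comm]; exact Submodule.smul_mem _ _ ha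
    | mem b hb =>
      obtain ⟨z, t, q, hq, rfl⟩ := hb
      by_cases h : y = z
      · subst h
        rw [ofPath_mul_ofPath]
        refine ofPath_mem_lengthFiltration _ ?_
        rw [Quiver.Path.length_comp]
        omega
      · rw [ofPath_mul_ofPath_of_ne _ _ h]
        exact Submodule.zero_mem _

theorem lengthFiltration_antitone {m m' : ℕ} (h : m ≤ m') :
    lengthFiltration k V m' ≤ lengthFiltration k V m := by
  refine Submodule.span_mono ?_
  rintro _ ⟨x, y, p, hp, rfl⟩
  exact ⟨x, y, p, h.trans hp, rfl⟩

theorem mem_lengthFiltration_zero (f : PathAlgebra k V) : f ∈ lengthFiltration k V 0 := by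
  induction f using induction_on with
  | zero => exact Submodule.zero_mem _
  | add a b ha hb => exact Submodule.add_mem _ ha hb
  | smul c p => exact Submodule.smul_mem _ _ (ofPath_mem_lengthFiltration p (Nat.zero_le _))

theorem span_le_lengthFiltration {s : Set (PathAlgebra k V)} {m : ℕ}
    (h : ∀ g ∈ s, g ∈ lengthFiltration k V m) {f : PathAlgebra k V}
    (hf : f ∈ TwoSidedIdeal.span s) : f ∈ lengthFiltration k V m := by
  refine mem_of_mem_span hf _ fun g hg {x y z t} p q => ?_
  have h1 := mul_mem_lengthFiltration (mul_mem_lengthFiltration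
    (mem_lengthFiltration_zero (ofPath k p)) (h g hg)) (mem_lengthFiltration_zero (ofPath k q))
  simpa using h1

/-- Together with `lengthFiltration_two_le` this is all that admissibility needs from the equality
of $F^m$ with the span of the paths of length at least $m$. -/
theorem arrowIdeal_pow_le (m : ℕ) {f : PathAlgebra k V}
    (hf : f ∈ (arrowIdeal k V).asIdeal ^ m) : f ∈ lengthFiltration k V m := by
  induction m generalizing f with
  | zero => exact mem_lengthFiltration_zero f
  | succ m ih =>
    rw [Submodule.pow_succ] at hf
    refine Submodule.mul_induction_on hf ?_ ?_
    · intro a ha b hb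
      refine mul_mem_lengthFiltration (ih ha) ?_
      refine span_le_lengthFiltration ?_ (TwoSidedIdeal.mem_asIdeal.1 hb)
      rintro _ ⟨x, y, α, rfl⟩
      exact ofPath_mem_lengthFiltration _ le_rfl
    · intro a b ha hb
      exact Submodule.add_mem _ ha hb

theorem lengthFiltration_two_le {f : PathAlgebra k V} (hf : f ∈ lengthFiltration k V 2) :
    f ∈ (arrowIdeal k V).asIdeal ^ 2 := by
  have harrow : ∀ {x y : V} (α : x ⟶ y), ofArrow k α ∈ arrowIdeal k V := fun {x y} α =>
    TwoSidedIdeal.subset_span ⟨x, y, α, rfl⟩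
  induction hf using Submodule.span_induction with
  | zero => exact Submodule.zero_mem _
  | add a b _ _ ha hb => exact Submodule.add_mem _ ha hb
  | smul c a _ ha =>
    have h : c • a = (c • (1 : PathAlgebra k V)) • a := by
      rw [smul_eq_mul, smul_mul_assoc, one_mul]
    rw [h]
    exact Submodule.smul_mem _ _ ha
  | mem a ha =>
    obtain ⟨x, y, p, hp, rfl⟩ := ha
    cases p with
    | nil => simp at hp
    | cons p α =>
      cases p with
      | nil => simp at hp
      | cons p β =>
        have e : (arrowIdeal k V).asIdeal ^ 2 = (arrowIdeal k V).asIdeal * (arrowIdeal k V).asIdeal :=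
          (Submodule.pow_succ (n := 1) (arrowIdeal k V).asIdeal).trans (by rw [Submodule.pow_one])
        rw [ofPath_cons, ofPath_cons, e]
        exact Submodule.mul_mem_mul
          (TwoSidedIdeal.mem_asIdeal.2 (TwoSidedIdeal.mul_mem_left _ _ _ (harrow β)))
          (TwoSidedIdeal.mem_asIdeal.2 (harrow α))

/-- A subideal of the square of the arrow ideal is admissible if all paths are short. -/
theorem isAdmissible_of_length_lt {I : TwoSidedIdeal (PathAlgebra k V)} (m : ℕ)
    (hm : ∀ {x y : V} (p : Quiver.Path x y), p.length < m)
    (hI : ∀ f ∈ I, f ∈ lengthFiltration k V 2) : IsAdmissible I := by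
  -- Already $F^m=0$; the summand `2` only secures the requirement that the exponent be at least
  -- two.
  refine ⟨m + 2, by omega, ?_, fun f hf => lengthFiltration_two_le (hI f hf)⟩
  intro f hf
  have h := lengthFiltration_antitone (Nat.le_add_right m 2) (arrowIdeal_pow_le _ hf)
  have h0 : lengthFiltration k V m ≤ ⊥ := by
    refine Submodule.span_le.2 ?_
    rintro _ ⟨x, y, p, hp, rfl⟩
    exact absurd (hm p) (by omega)
  rw [(Submodule.mem_bot k).1 (h0 h)]
  exact Submodule.zero_mem _

theorem map_mem_lengthFiltration (F : PathAlgebra k V →ₐ[k] PathAlgebra k V)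
    (hF : ∀ {x y : V} (α : x ⟶ y), F (ofArrow k α) ∈ lengthFiltration k V 1) {m : ℕ}
    {f : PathAlgebra k V} (hf : f ∈ lengthFiltration k V m) : F f ∈ lengthFiltration k V m := by
  have key : ∀ {x y : V} (p : Quiver.Path x y), F (ofPath k p) ∈ lengthFiltration k V p.length := by
    intro x y p
    induction p with
    | nil => exact mem_lengthFiltration_zero _
    | cons p α ih =>
      rw [ofPath_cons, map_mul]
      exact mul_mem_lengthFiltration ih (hF α)
  induction hf using Submodule.span_induction with
  | zero => rw [map_zero]; exact Submodule.zero_mem _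
  | add a b _ _ ha hb => rw [map_add]; exact Submodule.add_mem _ ha hb
  | smul c a _ ha => rw [map_smul]; exact Submodule.smul_mem _ _ ha
  | mem a ha =>
    obtain ⟨x, y, p, hp, rfl⟩ := ha
    exact lengthFiltration_antitone hp (key p)

end

end PathAlgebra

section BoundQuiver

open PathAlgebra

variable {V : Type*} [Quiver V]

/-! ### Weights of walks -/

section weight

variable {G : Type*} [Group G] (w : ∀ {x y : V}, (x ⟶ y) → G)

/-- The weight of a formal arrow: the inverse of an arrow has the inverse weight. -/
def symWeight {x y : Quiver.Symmetrify V} (α : x ⟶ y) : G :=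
  Sum.elim (fun β : @Quiver.Hom V _ x y => w β) (fun β : @Quiver.Hom V _ y x => (w β)⁻¹) α

/-- The weight of a walk. -/
def walkWeight {x y : Quiver.Symmetrify V} (u : Walk x y) : G :=
  Quiver.Path.weight (symWeight w) u

theorem walkWeight_comp {x y z : Quiver.Symmetrify V} (u : Walk x y) (v : Walk y z) :
    walkWeight w (u.comp v) = walkWeight w u * walkWeight w v :=
  Quiver.Path.weight_comp _ u v

theorem walkWeight_nil (x : Quiver.Symmetrify V) :
    walkWeight w (Quiver.Path.nil : Walk x x) = 1 :=
  Quiver.Path.weight_nil _ x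

theorem walkWeight_toPath {x y : Quiver.Symmetrify V} (α : x ⟶ y) :
    walkWeight w (Quiver.Hom.toPath α) = symWeight w α :=
  (Quiver.Path.weight_cons (symWeight w) Quiver.Path.nil α).trans
    (by rw [Quiver.Path.weight_nil, one_mul])

theorem walkWeight_cons {x y z : Quiver.Symmetrify V} (u : Walk x y) (α : y ⟶ z) :
    walkWeight w (u.cons α) = walkWeight w u * symWeight w α :=
  Quiver.Path.weight_cons (symWeight w) u α

theorem symWeight_reverse {x y : Quiver.Symmetrify V} (α : x ⟶ y) :
    symWeight w (Quiver.reverse α) = (symWeight w α)⁻¹ := by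
  rcases α with α | α
  · rfl
  · exact (inv_inv _).symm

theorem walkWeight_toPath_comp_reverse {x y : Quiver.Symmetrify V} (α : x ⟶ y) :
    walkWeight w ((Quiver.Hom.toPath α).comp (Quiver.Hom.toPath (Quiver.reverse α))) =
      walkWeight w (Quiver.Path.nil : Walk x x) := by
  rw [walkWeight_comp, walkWeight_toPath, walkWeight_toPath, symWeight_reverse, mul_inv_cancel,
    walkWeight_nil]

theorem walkWeight_toWalk {x y : V} (p : Quiver.Path x y) :
    walkWeight w p.toWalk = Quiver.Path.weight w p := by
  induction p with
  | nil => exact (walkWeight_nil w _).trans (Quiver.Path.weight_nil _ _).symm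
  | cons p α ih =>
    rw [Quiver.Path.weight_cons, ← ih]
    exact Quiver.Path.weight_cons (symWeight w) p.toWalk (Sum.inl α)

theorem walkWeight_reverse {x y : Quiver.Symmetrify V} (u : Walk x y) :
    walkWeight w u.reverse = (walkWeight w u)⁻¹ := by
  induction u with
  | nil => exact (walkWeight_nil w _).trans ((inv_one (G := G)).symm.trans
      (congrArg _ (walkWeight_nil w _).symm))
  | cons p α ih =>
    rw [Quiver.Path.reverse, walkWeight_comp, ih, walkWeight_cons, walkWeight_toPath,
      symWeight_reverse, mul_inv_rev]

variable {k : Type*} [Field k] [Fintype V]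

/-- Homotopic walks have the same weight if the ideal is generated by sums of two parallel paths
of the same weight. -/
theorem Homotopic.walkWeight_eq {s : Set (PathAlgebra k V)}
    (hs : ∀ g ∈ s, ∃ (x y : V) (u v : Quiver.Path x y),
      Quiver.Path.weight w u = Quiver.Path.weight w v ∧ g = ofPath k u + ofPath k v)
    {x y : Quiver.Symmetrify V} {u v : Walk x y} (h : Homotopic (TwoSidedIdeal.span s) u v) :
    walkWeight w u = walkWeight w v := by
  classical
  induction h with
  | refl => rfl
  | symm _ ih => exact ih.symm
  | trans _ _ ih ih' => exact ih.trans ih'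
  | mul_inv α => exact walkWeight_toPath_comp_reverse w (@Quiver.Hom.toPos V _ _ _ α)
  | inv_mul α => exact walkWeight_toPath_comp_reverse w (@Quiver.Hom.toNeg V _ _ _ α)
  | congr a b _ ih => rw [walkWeight_comp, walkWeight_comp, walkWeight_comp, walkWeight_comp, ih]
  | @minimal x y S c hm p q hp hq =>
    rw [walkWeight_toWalk, walkWeight_toWalk]
    by_contra hne
    -- The projection onto the span of the paths with the weight of `p`. It sends each product of a
    -- generator with two paths to itself or to `0`, so it preserves the ideal.
    let proj : PathAlgebra k V →ₗ[k] PathAlgebra k V := liftLin fun r =>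
      if Quiver.Path.weight w r.2.2 = Quiver.Path.weight w p then ofAny r else 0
    have hproj : ∀ {x y : V} (r : Quiver.Path x y), proj (ofPath k r) =
        if Quiver.Path.weight w r = Quiver.Path.weight w p then ofPath k r else 0 :=
      fun r => liftLin_ofPath _ r
    have hI : ∀ f ∈ TwoSidedIdeal.span s, proj f ∈ TwoSidedIdeal.span s := by
      intro f hf
      refine mem_of_mem_span hf ((idealSubmodule (TwoSidedIdeal.span s)).comap proj) ?_
      intro g hg x' y' z t a b
      change proj _ ∈ TwoSidedIdeal.span s
      have hgI := TwoSidedIdeal.subset_span hg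
      obtain ⟨x₁, y₁, u, v, huv, rfl⟩ := hs g hg
      by_cases h1 : y' = x₁
      · subst h1
        by_cases h2 : y₁ = z
        · subst h2
          have hmem := TwoSidedIdeal.mul_mem_right _ _ (ofPath k b)
            (TwoSidedIdeal.mul_mem_left _ (ofPath k a) _ hgI)
          rw [mul_add, add_mul, ofPath_mul_ofPath, ofPath_mul_ofPath, ofPath_mul_ofPath,
            ofPath_mul_ofPath] at hmem ⊢
          rw [map_add, hproj, hproj, Quiver.Path.weight_comp, Quiver.Path.weight_comp,
            Quiver.Path.weight_comp, Quiver.Path.weight_comp, huv]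
          split_ifs
          · exact hmem
          · rw [add_zero]; exact TwoSidedIdeal.zero_mem _
        · rw [mul_assoc, add_mul, ofPath_mul_ofPath_of_ne _ _ h2, ofPath_mul_ofPath_of_ne _ _ h2,
            add_zero, mul_zero, map_zero]
          exact TwoSidedIdeal.zero_mem _
      · rw [mul_add, ofPath_mul_ofPath_of_ne _ _ h1, ofPath_mul_ofPath_of_ne _ _ h1,
          add_zero, zero_mul, map_zero]
        exact TwoSidedIdeal.zero_mem _
    have hsum := hI _ hm.mem
    rw [map_sum] at hsum
    -- The terms of the same weight as `p` form a partial sum in the ideal; it contains `p` and, by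
    -- assumption, misses `q`, against minimality.
    refine hm.not_mem (S.filter fun r => Quiver.Path.weight w r = Quiver.Path.weight w p) ?_ ?_ ?_
    · rw [Finset.ssubset_iff_subset_ne]
      refine ⟨Finset.filter_subset _ _, fun e => hne ?_⟩
      rw [← e] at hq
      exact (Finset.mem_filter.1 hq).2.symm
    · exact ⟨p, Finset.mem_filter.2 ⟨hp, rfl⟩⟩
    · rw [Finset.sum_filter]
      convert hsum using 1
      refine Finset.sum_congr rfl fun r _ => ?_
      rw [map_smul, hproj]
      split_ifs
      · rfl
      · rw [smul_zero]

end weight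

/-! ### From relations to homotopies -/

variable {k : Type*} [Field k] [Fintype V]

/-- Two parallel paths whose sum lies in `I` are homotopic if they do not lie in `I` themselves. -/
theorem Homotopic.of_add_mem {I : TwoSidedIdeal (PathAlgebra k V)} {x y : V}
    {u v : Quiver.Path x y} (h : ofPath k u + ofPath k v ∈ I) (hu : ofPath k u ∉ I) :
    Homotopic I u.toWalk v.toWalk := by
  classical
  by_cases huv : u = v
  · rw [huv]; exact Homotopic.refl _
  have hv : ofPath k v ∉ I := fun hv => hu (by simpa using I.sub_mem h hv)
  have hm : IsMinimalRelation I {u, v} (fun _ => (1 : k)) := by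
    refine ⟨(Finset.card_pair huv).ge, fun _ _ => one_ne_zero, ?_, ?_⟩
    · rw [Finset.sum_pair huv, one_smul, one_smul]; exact h
    · intro J hJ hne
      have hJ' : J = {u} ∨ J = {v} := by
        have hsub := Finset.coe_subset.2 hJ.subset
        rw [Finset.coe_pair, Set.subset_pair_iff_eq] at hsub
        rcases hsub with h | h | h | h
        · exact absurd (Finset.coe_eq_empty.1 h) hne.ne_empty
        · exact Or.inl (Finset.coe_eq_singleton.1 h)
        · exact Or.inr (Finset.coe_eq_singleton.1 h)
        · rw [← Finset.coe_pair] at h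
          exact absurd (Finset.coe_injective h) hJ.ne
      rcases hJ' with rfl | rfl
      · rw [Finset.sum_singleton, one_smul]; exact hu
      · rw [Finset.sum_singleton, one_smul]; exact hv
  exact Homotopic.minimal hm (by simp) (by simp)

/-- If the elements of `I` between two vertices are the multiples of `g`, then all paths which
occur in `g` are homotopic. -/
theorem Homotopic.of_unique_relation {I : TwoSidedIdeal (PathAlgebra k V)} {x y : V}
    {g : PathAlgebra k V} (hg : g ∈ I) (hloc : vertex k x * g * vertex k y = g)
    (hI : ∀ f ∈ I, ∃ c : k, vertex k x * f * vertex k y = c • g)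
    {u v : Quiver.Path x y} (hu : coeff ⟨x, y, u⟩ g ≠ 0) (hv : coeff ⟨x, y, v⟩ g ≠ 0) :
    Homotopic I u.toWalk v.toWalk := by
  classical
  by_cases huv : u = v
  · rw [huv]; exact Homotopic.refl _
  have hm : IsMinimalRelation I (pathSupport g x y) (fun w => coeff ⟨x, y, w⟩ g) := by
    refine ⟨?_, fun w hw => mem_pathSupport.1 hw, ?_, ?_⟩
    · rw [← Finset.card_pair huv]
      refine Finset.card_le_card fun w hw => ?_
      rcases Finset.mem_insert.1 hw with rfl | hw
      · exact mem_pathSupport.2 hu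
      · rw [Finset.mem_singleton.1 hw]; exact mem_pathSupport.2 hv
    · rw [sum_pathSupport, hloc]; exact hg
    · intro J hJ ⟨w, hw⟩ hmem
      obtain ⟨c, hc⟩ := hI _ hmem
      have hcoeff : ∀ w' : Quiver.Path x y, (if w' ∈ J then coeff ⟨x, y, w'⟩ g else 0) =
          c * coeff ⟨x, y, w'⟩ g := by
        intro w'
        have h1 : vertex k x * (∑ w ∈ J, coeff ⟨x, y, w⟩ g • ofPath k w) * vertex k y =
            ∑ w ∈ J, coeff ⟨x, y, w⟩ g • ofPath k w := by
          rw [Finset.mul_sum, Finset.sum_mul]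
          refine Finset.sum_congr rfl fun w _ => ?_
          rw [mul_smul_comm, smul_mul_assoc, vertex_mul, mul_vertex]
        rw [h1] at hc
        have h2 := congrArg (coeff ⟨x, y, w'⟩) hc
        rw [map_sum, map_smul, smul_eq_mul] at h2
        rw [← h2]
        have h3 : ∀ w : Quiver.Path x y, coeff ⟨x, y, w'⟩ (coeff ⟨x, y, w⟩ g • ofPath k w) =
            if w' = w then coeff ⟨x, y, w⟩ g else 0 := by
          intro w
          rw [map_smul, ofPath_eq_ofAny]
          split_ifs with e
          · rw [e, coeff_ofAny_self, smul_eq_mul, mul_one]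
          · rw [coeff_ofAny_of_ne, smul_zero]
            intro e'
            exact e (anyPath_injective x y e').symm
        rw [Finset.sum_congr rfl fun w _ => h3 w, Finset.sum_ite_eq]
      -- The partial sum over `J` equals `c • g`. The coefficient at `w'` outside `J` forces `c =
      -- 0`, and then the coefficient at `w` in `J` vanishes.
      obtain ⟨w', hw', hw'J⟩ := Finset.exists_of_ssubset hJ
      have h1 := hcoeff w
      have h2 := hcoeff w'
      rw [if_pos hw] at h1
      rw [if_neg hw'J] at h2
      rcases mul_eq_zero.1 h2.symm with h0 | h0
      · rw [h0, zero_mul] at h1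
        exact mem_pathSupport.1 (hJ.subset hw) h1
      · exact mem_pathSupport.1 hw' h0
  exact Homotopic.minimal hm (mem_pathSupport.2 hu) (mem_pathSupport.2 hv)

/-! ### Based loops -/

section loopAt

variable (I : TwoSidedIdeal (PathAlgebra k V)) {b : Quiver.Symmetrify V}
  (τ : ∀ x : Quiver.Symmetrify V, Walk b x) (v : Quiver.Symmetrify V)

/-- The loop at `v` which follows the walks `τ` to and from the walk `u`. -/
def loopAt {x y : Quiver.Symmetrify V} (u : Walk x y) : Walk v v :=
  ((τ v).reverse.comp (((τ x).comp u).comp (τ y).reverse)).comp (τ v)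

variable {I}

theorem loopAt_congr {x y : Quiver.Symmetrify V} {u u' : Walk x y} (h : Homotopic I u u') :
    Homotopic I (loopAt τ v u) (loopAt τ v u') :=
  Homotopic.comp (Homotopic.comp (Homotopic.refl _)
    (Homotopic.comp (Homotopic.comp (Homotopic.refl _) h) (Homotopic.refl _))) (Homotopic.refl _)

/-- Between `u` and `u'` the loops run back along `τ y`, along `τ v`, back along `τ v` and along `τ
y` again, which cancels. -/
theorem loopAt_comp {x y z : Quiver.Symmetrify V} (u : Walk x y) (u' : Walk y z) :
    Homotopic I (loopAt τ v (u.comp u')) ((loopAt τ v u).comp (loopAt τ v u')) := by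
  have h1 := Homotopic.congr (I := I) ((τ y).reverse) (τ y) (Homotopic.comp_reverse (τ v))
  rw [Quiver.Path.comp_nil] at h1
  have h2 := Homotopic.congr ((τ v).reverse.comp ((τ x).comp u))
    ((u'.comp (τ z).reverse).comp (τ v)) (h1.trans (Homotopic.reverse_comp _))
  rw [Quiver.Path.comp_nil] at h2
  unfold loopAt
  simp only [Quiver.Path.comp_assoc] at h2 ⊢
  exact h2.symm

theorem loopAt_nil (x : Quiver.Symmetrify V) :
    Homotopic I (loopAt τ v (Quiver.Path.nil : Walk x x)) Quiver.Path.nil := by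
  have h1 := Homotopic.congr (I := I) (τ v).reverse (τ v) (Homotopic.comp_reverse (τ x))
  rw [Quiver.Path.comp_nil] at h1
  have h2 := h1.trans (Homotopic.reverse_comp _)
  unfold loopAt
  rw [Quiver.Path.comp_nil]
  exact h2

theorem loopAt_closed (u : Walk v v) : Homotopic I (loopAt τ v u) u := by
  have h1 := Homotopic.reverse_comp (I := I) (τ v)
  have h := Homotopic.comp (Homotopic.comp h1 (Homotopic.refl u)) h1
  rw [Quiver.Path.comp_nil, Quiver.Path.nil_comp] at h
  unfold loopAt
  simp only [Quiver.Path.comp_assoc] at h ⊢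
  exact h

/-- For an arrow of the tree the walk `τ x` followed by the arrow is `τ y` itself, so the loop
retraces its steps. -/
theorem loopAt_toPath {x y : Quiver.Symmetrify V} (α : x ⟶ y) (h : τ y = (τ x).cons α) :
    Homotopic I (loopAt τ v (Quiver.Hom.toPath α)) Quiver.Path.nil := by
  have h1 := Homotopic.congr (I := I) (τ v).reverse (τ v) (Homotopic.comp_reverse (τ y))
  rw [Quiver.Path.comp_nil] at h1
  have h2 := h1.trans (Homotopic.reverse_comp _)
  have e : (τ x).comp (Quiver.Hom.toPath α) = τ y := by rw [h]; rfl
  unfold loopAt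
  rw [e]
  exact h2

omit [Fintype V] in
theorem walkWeight_loopAt {G : Type*} [Group G] (w : ∀ {x y : V}, (x ⟶ y) → G)
    (hτ : ∀ x, walkWeight w (τ x) = 1) {x y : Quiver.Symmetrify V} (u : Walk x y) :
    walkWeight w (loopAt τ v u) = walkWeight w u := by
  unfold loopAt
  rw [walkWeight_comp, walkWeight_comp, walkWeight_comp, walkWeight_comp, walkWeight_reverse,
    walkWeight_reverse, hτ, hτ, hτ, inv_one, one_mul, mul_one, mul_one, one_mul]

end loopAt

section loopClass

variable (I : TwoSidedIdeal (PathAlgebra k V)) {b : Quiver.Symmetrify V}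
  (τ : ∀ x : Quiver.Symmetrify V, Walk b x) (v : V)

/-- The homotopy class of the loop at `v` which follows the walks `τ` to and from `u`. -/
def loopClass {x y : Quiver.Symmetrify V} (u : Walk x y) : FundamentalGroupBQ I v :=
  Quotient.mk (homotopySetoid I v) (loopAt τ v u)

variable {I}

theorem loopClass_congr {x y : Quiver.Symmetrify V} {u u' : Walk x y} (h : Homotopic I u u') :
    loopClass I τ v u = loopClass I τ v u' :=
  Quotient.sound (loopAt_congr τ v h)

theorem loopClass_comp {x y z : Quiver.Symmetrify V} (u : Walk x y) (u' : Walk y z) :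
    loopClass I τ v (u.comp u') = loopClass I τ v u * loopClass I τ v u' :=
  Quotient.sound (loopAt_comp τ v u u')

theorem loopClass_nil (x : Quiver.Symmetrify V) :
    loopClass I τ v (Quiver.Path.nil : Walk x x) = 1 :=
  Quotient.sound (loopAt_nil τ v x)

theorem loopClass_closed (u : Walk (V := V) v v) :
    loopClass I τ v u = Quotient.mk (homotopySetoid I v) u :=
  Quotient.sound (loopAt_closed τ v u)

variable (I) in
/-- The class of an arrow. -/
def arrowClass {x y : V} (α : x ⟶ y) : FundamentalGroupBQ I v :=
  loopClass I τ v (Quiver.Hom.toPath (V := Quiver.Symmetrify V) (@Quiver.Hom.toPos V _ _ _ α))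

theorem loopClass_toPath {x y : Quiver.Symmetrify V} (α : x ⟶ y) :
    loopClass I τ v (Quiver.Hom.toPath α) = symWeight (arrowClass I τ v) α := by
  rcases α with α | α
  · rfl
  · refine eq_inv_of_mul_eq_one_left ?_
    refine (loopClass_comp τ v _ _).symm.trans ?_
    rw [← loopClass_nil (I := I) τ v x]
    exact loopClass_congr τ v (Homotopic.inv_mul α)

/-- The fundamental group serves as its own group of weights. Hence classes of walks are products of
classes of arrows, and the arrows off the tree generate. -/
theorem loopClass_eq_walkWeight {x y : Quiver.Symmetrify V} (u : Walk x y) :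
    loopClass I τ v u = walkWeight (arrowClass I τ v) u := by
  induction u with
  | nil => rw [loopClass_nil, walkWeight_nil]
  | cons p α ih =>
    rw [walkWeight_cons, ← ih, ← Quiver.Path.comp_toPath_eq_cons, loopClass_comp, loopClass_toPath]

theorem loopClass_toWalk {x y : V} (p : Quiver.Path x y) :
    loopClass I τ v p.toWalk = Quiver.Path.weight (arrowClass I τ v) p :=
  (loopClass_eq_walkWeight τ v _).trans (walkWeight_toWalk _ p)

theorem arrowClass_eq_one {x y : V} (α : x ⟶ y)
    (h : τ y = Quiver.Path.cons (V := Quiver.Symmetrify V) (τ x) (@Quiver.Hom.toPos V _ _ _ α)) :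
    arrowClass I τ v α = 1 :=
  Quotient.sound (loopAt_toPath τ v (@Quiver.Hom.toPos V _ _ _ α) h)

end loopClass

end BoundQuiver

/-! ### Words along the chain and their weights -/

namespace Chain

open PathAlgebra

variable {n : ℕ}

/-- The weight of arrows which is trivial on the `a_i` and the `r_i`. -/
def arrowWeight {M : Type*} [Monoid M] (m : Fin n → M) :
    ∀ {x y : ChainVertex n}, (x ⟶ y) → M := fun {_ _} α =>
  match α with
  | ChainArrow.r _ => 1
  | ChainArrow.l i => m i
  | ChainArrow.a _ => 1

/-- The height of a vertex; all arrows increase it. -/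
def height : ChainVertex n → ℕ
  | .x i => 2 * i
  | .y i => 2 * i + 1

theorem height_lt {x y : ChainVertex n} (α : ChainArrow n x y) : height x < height y := by
  cases α <;> simp only [height, Fin.val_castSucc, Fin.val_succ] <;> omega

theorem height_add_length_le {x y : ChainVertex n} (p : Quiver.Path x y) :
    height x + p.length ≤ height y := by
  induction p with
  | nil => exact le_rfl
  | @cons y z p α ih =>
    rw [Quiver.Path.length_cons]
    have h : height y < height z := height_lt α
    omega

theorem height_le (x : ChainVertex n) : height x ≤ 2 * n := by
  rcases x with i | i <;> simp only [height] <;> omega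

theorem isAcyclicQuiver : IsAcyclicQuiver (ChainVertex n) := fun x p =>
  Quiver.Path.eq_nil_of_length_zero p (by have := height_add_length_le p; omega)

/-- The arrow `r_i`. -/
def arrowR (i : Fin n) : (ChainVertex.x i.castSucc : ChainVertex n) ⟶ ChainVertex.y i :=
  ChainArrow.r i

/-- The arrow `l_i`. -/
def arrowL (i : Fin n) : (ChainVertex.y i : ChainVertex n) ⟶ ChainVertex.x i.succ :=
  ChainArrow.l i

/-- The path `a_i` or `A_i`. -/
def step (ε : Bool) (t : Fin n) :
    Quiver.Path (ChainVertex.x t.castSucc : ChainVertex n) (ChainVertex.x t.succ) :=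
  match ε with
  | true => (Quiver.Path.nil.cons (arrowR t)).cons (arrowL t)
  | false => Quiver.Path.nil.cons (arrowA t)

theorem weight_step {M : Type*} [Monoid M] (m : Fin n → M) (ε : Bool) (t : Fin n) :
    Quiver.Path.weight (arrowWeight m) (step ε t) = if ε then m t else 1 := by
  cases ε
  · rw [step, Quiver.Path.weight_cons, Quiver.Path.weight_nil]
    exact one_mul _
  · rw [step, Quiver.Path.weight_cons, Quiver.Path.weight_cons, Quiver.Path.weight_nil]
    exact (congrArg (· * m t) (one_mul _)).trans (one_mul _)

/-- The indices `i, i + 1, …, i + d - 1`. -/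
def interval (i : ℕ) : (d : ℕ) → i + d ≤ n → List (Fin n)
  | 0, _ => []
  | d + 1, h => interval i d (by omega) ++ [⟨i + d, by omega⟩]

theorem mem_interval {i d : ℕ} {h : i + d ≤ n} {t : Fin n} :
    t ∈ interval i d h ↔ i ≤ t ∧ (t : ℕ) < i + d := by
  induction d with
  | zero => simp only [interval, List.not_mem_nil, false_iff]; omega
  | succ d ih =>
    rw [interval, List.mem_append, ih, List.mem_singleton, Fin.ext_iff]
    simp only
    omega

theorem pairwise_interval {i d : ℕ} {h : i + d ≤ n} : (interval i d h).Pairwise (· < ·) := by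
  induction d with
  | zero => exact List.Pairwise.nil
  | succ d ih =>
    rw [interval, List.pairwise_append]
    refine ⟨ih, List.pairwise_singleton _ _, fun s hs t ht => ?_⟩
    rw [List.mem_singleton.1 ht, Fin.lt_def]
    exact (mem_interval.1 hs).2

theorem pairwise_block (i j : Fin n) : (block i j).Pairwise (· < ·) :=
  (List.pairwise_lt_finRange n).filter _

theorem mem_block {i j t : Fin n} : t ∈ block i j ↔ i ≤ t ∧ t ≤ j := by
  simp [block]

theorem pairwise_between (i j : Fin n) : (between i j).Pairwise (· < ·) :=
  (List.pairwise_lt_finRange n).filter _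

theorem mem_between {i j t : Fin n} : t ∈ between i j ↔ i < t ∧ t < j := by
  simp [between]

/-- `interval` grows at its right end, as paths do, and so allows induction on the length; `block`
is the form used in the statement. -/
theorem block_eq_interval {i j : Fin n} (h : i ≤ j) :
    block i j = interval i (j - i + 1) (by have := j.2; have : (i : ℕ) ≤ j := h; omega) := by
  refine List.Pairwise.eq_of_mem_iff (pairwise_block i j) pairwise_interval fun t => ?_
  rw [mem_block, mem_interval, Fin.le_def, Fin.le_def]
  have : (i : ℕ) ≤ j := h
  omega

theorem block_eq_between {i j : Fin n} (h : i < j) : block i j = i :: (between i j ++ [j]) := by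
  refine List.Pairwise.eq_of_mem_iff (r := (· < ·)) (pairwise_block i j) ?_ fun t => ?_
  · rw [List.pairwise_cons, List.pairwise_append]
    refine ⟨fun t ht => ?_, pairwise_between i j, List.pairwise_singleton _ _, fun s hs t ht => ?_⟩
    · rcases List.mem_append.1 ht with ht | ht
      · exact (mem_between.1 ht).1
      · rwa [List.mem_singleton.1 ht]
    · rw [List.mem_singleton.1 ht]
      exact (mem_between.1 hs).2
  · rw [mem_block, List.mem_cons, List.mem_append, mem_between, List.mem_singleton]
    simp only [Fin.le_def, Fin.lt_def, Fin.ext_iff] at h ⊢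
    omega

/-- The path from `x_i` to `x_{i+d}` which runs through `A_t` if `ε t` and through `a_t`
otherwise. -/
def segment (ε : Fin n → Bool) (i : ℕ) : (d : ℕ) → (h : i + d ≤ n) →
    Quiver.Path (ChainVertex.x ⟨i, by omega⟩ : ChainVertex n) (ChainVertex.x ⟨i + d, by omega⟩)
  | 0, _ => Quiver.Path.nil
  | d + 1, h => (segment ε i d (by omega)).comp
      (step (ε ⟨i + d, by omega⟩) ⟨i + d, by omega⟩)

theorem weight_segment {M : Type*} [Monoid M] (m : Fin n → M) (ε : Fin n → Bool) (i d : ℕ)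
    (h : i + d ≤ n) : Quiver.Path.weight (arrowWeight m) (segment ε i d h) =
      ((interval i d h).map fun t => if ε t then m t else 1).prod := by
  induction d with
  | zero => exact Quiver.Path.weight_nil _ _
  | succ d ih =>
    rw [interval, List.map_append, List.prod_append, List.map_singleton, List.prod_singleton, ← ih,
      ← weight_step]
    exact Quiver.Path.weight_comp _ _ _

/-- The path from `x_i` to `x_{j+1}` which runs through `A_t` if `ε t` and through `a_t`
otherwise. -/
def word (ε : Fin n → Bool) {i j : Fin n} (h : i ≤ j) :
    Quiver.Path (ChainVertex.x i.castSucc : ChainVertex n) (ChainVertex.x j.succ) :=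
  (segment ε i (j - i + 1) (by have := j.2; have : (i : ℕ) ≤ j := h; omega)).cast rfl
    (congrArg ChainVertex.x (Fin.ext (by
      have : (i : ℕ) ≤ j := h
      simp only [Fin.val_succ]; omega)))

/-- Among all paths with variable end points a cast is invisible; this removes the cast from `word`.
-/
theorem anyPath_cast {V : Type*} [Quiver V] {x y y' : V} (p : Quiver.Path x y) (e : y = y') :
    (⟨x, y', p.cast rfl e⟩ : AnyPath V) = ⟨x, y, p⟩ := by
  subst e; rfl

theorem weight_word {M : Type*} [Monoid M] (m : Fin n → M) (ε : Fin n → Bool) {i j : Fin n}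
    (h : i ≤ j) : Quiver.Path.weight (arrowWeight m) (word ε h) =
      ((block i j).map fun t => if ε t then m t else 1).prod := by
  rw [block_eq_interval h, ← weight_segment]
  exact congrArg (fun p : AnyPath (ChainVertex n) => Quiver.Path.weight (arrowWeight m) p.2.2)
    (anyPath_cast _ _)

theorem weight_word_false {M : Type*} [Monoid M] (m : Fin n → M) {i j : Fin n} (h : i ≤ j) :
    Quiver.Path.weight (arrowWeight m) (word (fun _ => false) h) = 1 := by
  rw [weight_word]
  exact List.prod_eq_one (by simp)

theorem weight_word_true {M : Type*} [Monoid M] (m : Fin n → M) {i j : Fin n} (h : i ≤ j) :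
    Quiver.Path.weight (arrowWeight m) (word (fun _ => true) h) = ((block i j).map m).prod := by
  rw [weight_word]
  simp

theorem prod_map_single {M : Type*} [Monoid M] (m : Fin n → M) (t : Fin n) (l : List (Fin n))
    (hl : l.Nodup) (ht : t ∈ l) : (l.map fun s => if decide (s = t) then m s else 1).prod = m t := by
  induction l with
  | nil => simp at ht
  | cons a l ih =>
    rw [List.nodup_cons] at hl
    rw [List.map_cons, List.prod_cons]
    rcases List.mem_cons.1 ht with rfl | ht
    · rw [List.prod_eq_one, mul_one]
      · simp
      · intro x hx
        obtain ⟨s, hs, rfl⟩ := List.mem_map.1 hx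
        rw [if_neg]
        simp only [decide_eq_true_eq]
        rintro rfl
        exact hl.1 hs
    · rw [ih hl.2 ht, if_neg, one_mul]
      simp only [decide_eq_true_eq]
      rintro rfl
      exact hl.1 ht

theorem weight_word_single {M : Type*} [Monoid M] (m : Fin n → M) {i j t : Fin n} (h : i ≤ j)
    (hi : i ≤ t) (hj : t ≤ j) :
    Quiver.Path.weight (arrowWeight m) (word (fun s => decide (s = t)) h) = m t := by
  rw [weight_word]
  exact prod_map_single m t _ ((pairwise_block i j).imp (fun h => h.ne)) (mem_block.2 ⟨hi, hj⟩)

/-! ### Lassos as sums of paths and the coefficients of their images -/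

variable (k : Type u) [Field k]

theorem A_eq (t : Fin n) : A k t = ofArrow k (arrowR t) * ofArrow k (arrowL t) :=
  (ofPath_mul_ofPath _ _).symm

theorem ofPath_step (ε : Bool) (t : Fin n) :
    ofPath k (step ε t) = if ε then A k t else a k t := by
  cases ε
  · rfl
  · rfl

/-- The segment must be nonempty: the empty one is a stationary path, whereas the empty product is
`1`, the sum of all of them. -/
theorem ofPath_segment (ε : Fin n → Bool) (i d : ℕ) (h : i + (d + 1) ≤ n) :
    ofPath k (segment ε i (d + 1) h) =
      ((interval i (d + 1) h).map fun t => if ε t then A k t else a k t).prod := by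
  induction d with
  | zero =>
    rw [interval, interval, List.nil_append, List.map_singleton, List.prod_singleton, ← ofPath_step]
    exact congrArg _ (Quiver.Path.nil_comp _)
  | succ d ih =>
    rw [interval, List.map_append, List.prod_append, List.map_singleton, List.prod_singleton,
      ← ih, ← ofPath_step]
    exact (ofPath_mul_ofPath _ _).symm

theorem ofPath_word (ε : Fin n → Bool) {i j : Fin n} (h : i ≤ j) :
    ofPath k (word ε h) = ((block i j).map fun t => if ε t then A k t else a k t).prod := by
  rw [block_eq_interval h, ← ofPath_segment]
  exact congrArg ofAny (anyPath_cast _ _)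

theorem lasso_eq {i j : Fin n} (h : i < j) :
    lasso k i j = ofPath k (word (fun _ => false) h.le) + ofPath k (word (fun _ => true) h.le) := by
  rw [ofPath_word, ofPath_word, lasso]
  simp

theorem crossLasso_eq {i j : Fin n} (h : i < j) :
    crossLasso k i j = ofPath k (word (fun s => decide (s = j)) h.le) +
      ofPath k (word (fun s => decide (s = i)) h.le) := by
  have hj : (between i j).map (fun t => if decide (t = j) then A k t else a k t) =
      (between i j).map (a k) := by
    refine List.map_congr_left fun t ht => ?_
    rw [if_neg]
    simpa using (mem_between.1 ht).2.ne
  have hi : (between i j).map (fun t => if decide (t = i) then A k t else a k t) =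
      (between i j).map (a k) := by
    refine List.map_congr_left fun t ht => ?_
    rw [if_neg]
    simpa using (mem_between.1 ht).1.ne'
  rw [ofPath_word, ofPath_word, crossLasso, block_eq_between h]
  simp only [List.map_cons, List.map_append, hj, hi]
  simp [h.ne, h.ne', mul_assoc]

/-- In the expansion of the product each word arises exactly once: at every index, comparing the
last arrow selects just one of the summands `a k t` and `A k t`. The vertex in front makes the empty
product a stationary path. -/
theorem coeff_segment (ε : Fin n → Bool) (i d : ℕ) (h : i + d ≤ n) :
    coeff ⟨_, _, segment ε i d h⟩ (vertex k (ChainVertex.x ⟨i, by omega⟩) *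
      ((interval i d h).map fun t => a k t + A k t).prod) = 1 := by
  induction d with
  | zero =>
    rw [interval, List.map_nil, List.prod_nil, mul_one]
    exact coeff_ofAny_self _
  | succ d ih =>
    have h' : i + d ≤ n := by omega
    rw [interval, List.map_append, List.prod_append, List.map_singleton, List.prod_singleton,
      ← mul_assoc, mul_add, map_add, A_eq, ← mul_assoc]
    have e : (segment ε i (d + 1) h) = (segment ε i d h').comp
      (step (ε ⟨i + d, by omega⟩) ⟨i + d, by omega⟩) := rfl
    rw [e]
    cases ε ⟨i + d, by omega⟩
    · refine Eq.trans (congrArg₂ (· + ·) ((coeff_mul_ofArrow _ (segment ε i d h')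
        (arrowA ⟨i + d, by omega⟩)).trans (ih h')) (coeff_mul_ofArrow_of_ne _ (segment ε i d h')
        (arrowA ⟨i + d, by omega⟩) (arrowL ⟨i + d, by omega⟩) ?_)) (add_zero 1)
      intro e; cases e
    · refine Eq.trans (congrArg₂ (· + ·) (coeff_mul_ofArrow_of_ne _
        ((segment ε i d h').cons (arrowR ⟨i + d, by omega⟩))
        (arrowL ⟨i + d, by omega⟩) (arrowA ⟨i + d, by omega⟩) ?_)
        ((coeff_mul_ofArrow _ ((segment ε i d h').cons (arrowR ⟨i + d, by omega⟩))
        (arrowL ⟨i + d, by omega⟩)).trans ((coeff_mul_ofArrow _ (segment ε i d h')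
        (arrowR ⟨i + d, by omega⟩)).trans (ih h')))) (zero_add 1)
      intro e; cases e

theorem vertex_mul_prod {i j : Fin n} (h : i ≤ j) (f : Fin n → PathAlgebra k (ChainVertex n))
    (hf : vertex k (ChainVertex.x i.castSucc) * f i = f i) :
    vertex k (ChainVertex.x i.castSucc) * ((block i j).map f).prod = ((block i j).map f).prod := by
  have e : ∃ l, block i j = i :: l := by
    rcases h.eq_or_lt with rfl | h
    · refine ⟨[], List.Pairwise.eq_of_mem_iff (pairwise_block i i) (List.pairwise_singleton _ _) ?_⟩
      intro t
      rw [mem_block, List.mem_singleton]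
      exact ⟨fun h => le_antisymm h.2 h.1, fun h => by rw [h]; exact ⟨le_rfl, le_rfl⟩⟩
    · exact ⟨_, block_eq_between h⟩
  obtain ⟨l, e⟩ := e
  rw [e, List.map_cons, List.prod_cons, ← mul_assoc, hf]

theorem vertex_mul_a (t : Fin n) : vertex k (ChainVertex.x t.castSucc) * a k t = a k t :=
  vertex_mul _

theorem vertex_mul_A (t : Fin n) : vertex k (ChainVertex.x t.castSucc) * A k t = A k t :=
  vertex_mul _

theorem a_mul_vertex (t : Fin n) : a k t * vertex k (ChainVertex.x t.succ) = a k t :=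
  mul_vertex _

theorem A_mul_vertex (t : Fin n) : A k t * vertex k (ChainVertex.x t.succ) = A k t :=
  mul_vertex _

theorem coeff_word (ε : Fin n → Bool) {i j : Fin n} (h : i ≤ j) :
    coeff ⟨_, _, word ε h⟩ ((block i j).map fun t => a k t + A k t).prod = 1 := by
  rw [← vertex_mul_prod k h _ (by rw [mul_add, vertex_mul_a, vertex_mul_A]), block_eq_interval h]
  have e : (⟨_, _, word ε h⟩ : AnyPath (ChainVertex n)) =
    ⟨_, _, segment ε i (j - i + 1) (by have := j.2; have : (i : ℕ) ≤ j := h; omega)⟩ :=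
    anyPath_cast _ _
  rw [e]
  exact coeff_segment k ε i _ _

/-- Words which avoid some `A_s` differ from `A_i ⋯ A_j`. -/
theorem word_ne_word_true {ε : Fin n → Bool} {i j s : Fin n} (h : i ≤ j) (hi : i ≤ s) (hj : s ≤ j)
    (hs : ε s = false) : word (fun _ => true) h ≠ word ε h := by
  intro e
  -- The weight in `ℕ` that is `0` at `s` and `1` elsewhere tells whether a word uses $A_s$.
  have e' := congrArg (Quiver.Path.weight (arrowWeight fun t => if t = s then 0 else 1)) e
  rw [weight_word_true, weight_word, List.prod_eq_zero, List.prod_eq_one] at e'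
  · exact zero_ne_one e'
  · intro x hx
    obtain ⟨t, -, rfl⟩ := List.mem_map.1 hx
    by_cases ht : t = s
    · rw [ht, hs]; rfl
    · simp [ht]
  · exact List.mem_map.2 ⟨s, mem_block.2 ⟨hi, hj⟩, by simp⟩

/-- The path `A_i ⋯ A_j` has coefficient `2` in the image of a lasso, all other words have
coefficient `1`. -/
theorem coeff_word_image_lasso {ε : Fin n → Bool} {i j s : Fin n} (h : i ≤ j) (hi : i ≤ s)
    (hj : s ≤ j) (hs : ε s = false) : coeff ⟨_, _, word ε h⟩
      (((block i j).map fun t => a k t + A k t).prod + ((block i j).map (A k)).prod) = 1 := by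
  have e : ((block i j).map (A k)).prod = ofPath k (word (fun _ => true) h) := by
    rw [ofPath_word]; simp
  rw [map_add, coeff_word, e, ofPath_eq_ofAny, coeff_ofAny_of_ne, add_zero]
  exact fun e => word_ne_word_true h hi hj hs (anyPath_injective _ _ e)

end Chain

namespace Chain

open PathAlgebra

variable {n : ℕ} (k : Type u) [Field k]

/-! ### The transvections of the chain of triangles -/

/-- The values of a transvection on the arrows. -/
noncomputable def shearArrow (i : Fin n) (c : k) :
    ∀ {x y : ChainVertex n}, (x ⟶ y) → PathAlgebra k (ChainVertex n) := fun {_ _} α =>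
  match α with
  | ChainArrow.r j => ofArrow k (arrowR j)
  | ChainArrow.l j => ofArrow k (arrowL j)
  | ChainArrow.a j => a k j + (if j = i then c else 0) • A k j

theorem shearArrow_mul_vertex (i : Fin n) (c : k) {x y : ChainVertex n} (α : ChainArrow n x y) :
    shearArrow k i c α * vertex k y = shearArrow k i c α := by
  cases α with
  | r j => exact mul_vertex _
  | l j => exact mul_vertex _
  | a j =>
    change (a k j + _ • A k j) * _ = a k j + _ • A k j
    rw [add_mul, smul_mul_assoc, a_mul_vertex, A_mul_vertex]

theorem vertex_mul_shearArrow (i : Fin n) (c : k) {x y : ChainVertex n} (α : ChainArrow n x y) :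
    vertex k x * shearArrow k i c α = shearArrow k i c α := by
  cases α with
  | r j => exact vertex_mul _
  | l j => exact vertex_mul _
  | a j =>
    change _ * (a k j + _ • A k j) = a k j + _ • A k j
    rw [mul_add, mul_smul_comm, vertex_mul_a, vertex_mul_A]

/-- The endomorphism `a_i ↦ a_i + c A_i`. -/
noncomputable def shear (i : Fin n) (c : k) :
    PathAlgebra k (ChainVertex n) →ₐ[k] PathAlgebra k (ChainVertex n) :=
  arrowMap (shearArrow k i c) (shearArrow_mul_vertex k i c)

theorem shear_vertex (i : Fin n) (c : k) (x : ChainVertex n) :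
    shear k i c (vertex k x) = vertex k x :=
  lift_vertex (vertex k) (shearArrow k i c) vertex_mul_vertex vertex_mul_vertex_of_ne one_def.symm
    (shearArrow_mul_vertex k i c) x

theorem shear_ofArrow (i : Fin n) (c : k) {x y : ChainVertex n} (α : x ⟶ y) :
    shear k i c (ofArrow k α) = shearArrow k i c α :=
  lift_ofArrow (vertex k) (shearArrow k i c) vertex_mul_vertex vertex_mul_vertex_of_ne one_def.symm
    (shearArrow_mul_vertex k i c) (vertex_mul_shearArrow k i c) α

theorem shear_A (i : Fin n) (c : k) (j : Fin n) : shear k i c (A k j) = A k j := by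
  rw [A_eq, map_mul, shear_ofArrow, shear_ofArrow]
  rfl

theorem shear_a (i : Fin n) (c : k) (j : Fin n) :
    shear k i c (a k j) = a k j + (if j = i then c else 0) • A k j :=
  shear_ofArrow k i c (arrowA j)

/-- Since $A_i$ is fixed, the scalars of successive shears add up; so the shear by `-c` inverts the
shear by `c`. -/
theorem shear_comp (i : Fin n) (c d : k) (h : d + c = 0) :
    (shear k i c).comp (shear k i d) = AlgHom.id k _ := by
  refine algHom_ext (fun x => ?_) (fun {x y} α => ?_)
  · rw [AlgHom.comp_apply, shear_vertex, shear_vertex]; rfl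
  · rw [AlgHom.comp_apply, shear_ofArrow]
    change ChainArrow n x y at α
    cases α with
    | r j => exact shear_ofArrow k i c (arrowR j)
    | l j => exact shear_ofArrow k i c (arrowL j)
    | a j =>
      change shear k i c (a k j + _ • A k j) = a k j
      rw [map_add, map_smul, shear_A, shear_a, add_assoc, ← add_smul]
      split_ifs
      · rw [add_comm c d, h, zero_smul, add_zero]
      · rw [add_zero, zero_smul, add_zero]

/-- The transvection `a_i ↦ a_i + A_i`. -/
noncomputable def transvection (i : Fin n) :
    PathAlgebra k (ChainVertex n) ≃ₐ[k] PathAlgebra k (ChainVertex n) :=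
  AlgEquiv.ofAlgHom (shear k i 1) (shear k i (-1)) (shear_comp k i _ _ (by ring))
    (shear_comp k i _ _ (by ring))

theorem isTransvection (i : Fin n) : IsTransvection (transvection k i) (arrowA i) 1 (pathA i) where
  coeff_ne_zero := one_ne_zero
  two_le_length := le_rfl
  map_vertex := shear_vertex k i 1
  map_arrow := by
    refine (shear_a k i 1 i).trans ?_
    rw [if_pos rfl]
    rfl
  map_other := by
    intro z t α hα
    refine (shear_ofArrow k i 1 α).trans ?_
    change ChainArrow n z t at α
    cases α with
    | r j => rfl
    | l j => rfl
    | a j =>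
      have hj : j ≠ i := by
        rintro rfl
        exact hα rfl
      change a k j + _ • A k j = a k j
      rw [if_neg hj, zero_smul, add_zero]

/-- The composition of all transvections. -/
noncomputable def shearAll (n : ℕ) : PathAlgebra k (ChainVertex n) ≃ₐ[k] PathAlgebra k (ChainVertex n) :=
  -- Multiplication of automorphisms is composition, so the reversal lets the transvection of
  -- smallest index act first.
  (List.ofFn (transvection (n := n) k)).reverse.prod

theorem shearAll_eq : shearAll k n = ((List.finRange n).reverse.map (transvection k)).prod := by
  rw [shearAll, List.ofFn_eq_map, List.map_reverse]

theorem prod_transvection_apply_eq {f : PathAlgebra k (ChainVertex n)}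
    (hf : ∀ i, transvection k i f = f) (l : List (Fin n)) : (l.map (transvection k)).prod f = f := by
  induction l with
  | nil => rfl
  | cons i l ih => rw [List.map_cons, List.prod_cons, AlgEquiv.mul_apply, ih, hf]

theorem prod_transvection_a (l : List (Fin n)) (hl : l.Nodup) (j : Fin n) :
    (l.map (transvection k)).prod (a k j) = a k j + (if j ∈ l then (1 : k) else 0) • A k j := by
  induction l with
  | nil => rw [if_neg List.not_mem_nil, zero_smul, add_zero]; rfl
  | cons i l ih =>
    rw [List.nodup_cons] at hl
    rw [List.map_cons, List.prod_cons, AlgEquiv.mul_apply, ih hl.2, map_add, map_smul]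
    have h1 : transvection k i (A k j) = A k j := shear_A k i 1 j
    have h2 : transvection k i (a k j) = a k j + (if j = i then (1 : k) else 0) • A k j :=
      shear_a k i 1 j
    rw [h1, h2, add_assoc, ← add_smul]
    congr 2
    by_cases hj : j = i
    · subst hj
      simp [hl.1]
    · simp [hj]

theorem shearAll_vertex (x : ChainVertex n) : shearAll k n (vertex k x) = vertex k x := by
  rw [shearAll_eq]
  exact prod_transvection_apply_eq k (fun i => shear_vertex k i 1 x) _

theorem shearAll_A (j : Fin n) : shearAll k n (A k j) = A k j := by
  rw [shearAll_eq]
  exact prod_transvection_apply_eq k (fun i => shear_A k i 1 j) _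

theorem shearAll_a (j : Fin n) : shearAll k n (a k j) = a k j + A k j := by
  rw [shearAll_eq, prod_transvection_a k _ (List.nodup_reverse.2 (List.nodup_finRange n)),
    if_pos (List.mem_reverse.2 (List.mem_finRange j)), one_smul]

theorem shearAll_ofArrow_mem {x y : ChainVertex n} (α : x ⟶ y) :
    shearAll k n (ofArrow k α) ∈ lengthFiltration k (ChainVertex n) 1 := by
  change ChainArrow n x y at α
  cases α with
  | r j =>
    have h : shearAll k n (ofArrow k (arrowR j)) = ofArrow k (arrowR j) := by
      rw [shearAll_eq]
      exact prod_transvection_apply_eq k (fun i => shear_ofArrow k i 1 (arrowR j)) _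
    change shearAll k n (ofArrow k (arrowR j)) ∈ _
    rw [h]
    exact ofPath_mem_lengthFiltration _ le_rfl
  | l j =>
    have h : shearAll k n (ofArrow k (arrowL j)) = ofArrow k (arrowL j) := by
      rw [shearAll_eq]
      exact prod_transvection_apply_eq k (fun i => shear_ofArrow k i 1 (arrowL j)) _
    change shearAll k n (ofArrow k (arrowL j)) ∈ _
    rw [h]
    exact ofPath_mem_lengthFiltration _ le_rfl
  | a j =>
    have h : shearAll k n (ofArrow k (arrowA j)) = a k j + A k j := shearAll_a k j
    change shearAll k n (ofArrow k (arrowA j)) ∈ _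
    rw [h]
    refine Submodule.add_mem _ ?_ ?_
    · exact ofPath_mem_lengthFiltration _ le_rfl
    · exact ofPath_mem_lengthFiltration _ one_le_two

theorem shearAll_lasso (i j : Fin n) : shearAll k n (lasso k i j) =
    ((block i j).map fun t => a k t + A k t).prod + ((block i j).map (A k)).prod := by
  rw [lasso, map_add, map_list_prod, map_list_prod, List.map_map, List.map_map]
  congr 3
  · funext t; exact shearAll_a k t
  · funext t; exact shearAll_A k t

/-! ### The tree of the `a_i` and the `r_i` -/

/-- The path `a_1 ⋯ a_i`. -/
def spine : (i : ℕ) → (h : i < n + 1) →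
    Walk (V := ChainVertex n) (ChainVertex.x 0) (ChainVertex.x ⟨i, h⟩)
  | 0, _ => Quiver.Path.nil
  | i + 1, h => Quiver.Path.cons (V := Quiver.Symmetrify (ChainVertex n)) (spine i (by omega))
      (@Quiver.Hom.toPos (ChainVertex n) _ _ _ (arrowA ⟨i, by omega⟩))

/-- The walk in the tree from `x_1` to a vertex. -/
def tree : ∀ v : Quiver.Symmetrify (ChainVertex n), Walk (V := ChainVertex n) (ChainVertex.x 0) v
  | .x i => spine i i.2
  | .y i => Quiver.Path.cons (V := Quiver.Symmetrify (ChainVertex n)) (spine i (by omega))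
      (@Quiver.Hom.toPos (ChainVertex n) _ _ _ (arrowR i))

theorem walkWeight_spine {G : Type*} [Group G] (m : Fin n → G) (i : ℕ) (h : i < n + 1) :
    walkWeight (arrowWeight m) (spine i h) = 1 := by
  induction i with
  | zero => exact walkWeight_nil _ _
  | succ i ih =>
    refine (walkWeight_cons (arrowWeight m) (spine i (by omega))
      (@Quiver.Hom.toPos (ChainVertex n) _ _ _ (arrowA ⟨i, by omega⟩))).trans ?_
    rw [ih]
    exact one_mul _

theorem walkWeight_tree {G : Type*} [Group G] (m : Fin n → G)
    (v : Quiver.Symmetrify (ChainVertex n)) : walkWeight (arrowWeight m) (tree v) = 1 := by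
  rcases v with i | i
  · exact walkWeight_spine m i i.2
  · refine (walkWeight_cons (arrowWeight m) (spine (n := n) i (by omega))
      (@Quiver.Hom.toPos (ChainVertex n) _ _ _ (arrowR i))).trans ?_
    rw [walkWeight_spine]
    exact one_mul _

theorem isFiniteConnectedQuiver : IsFiniteConnectedQuiver (ChainVertex n) where
  finite_vertices := inferInstance
  finite_arrows := by
    intro x y
    have h : Finite (Σ x y : ChainVertex n, (x ⟶ y)) := by
      refine Finite.of_surjective (α := Fin n ⊕ Fin n ⊕ Fin n) (Sum.elim
        (fun i => ⟨_, _, arrowR i⟩) (Sum.elim (fun i => ⟨_, _, arrowL i⟩)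
          (fun i => ⟨_, _, arrowA i⟩))) ?_
      rintro ⟨x, y, α⟩
      change ChainArrow n x y at α
      cases α with
      | r i => exact ⟨Sum.inl i, rfl⟩
      | l i => exact ⟨Sum.inr (Sum.inl i), rfl⟩
      | a i => exact ⟨Sum.inr (Sum.inr i), rfl⟩
    refine Finite.of_injective
      (fun α : x ⟶ y => (⟨x, y, α⟩ : Σ x y : ChainVertex n, (x ⟶ y))) fun α β e => ?_
    exact eq_of_heq (Sigma.mk.inj_iff.1 (eq_of_heq (Sigma.mk.inj_iff.1 e).2)).2
  nonempty := ⟨ChainVertex.x 0⟩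
  connected := fun x y => ⟨(tree (n := n) x).reverse.comp (tree y)⟩

section

variable {k} {I : TwoSidedIdeal (PathAlgebra k (ChainVertex n))} (v : ChainVertex n)

/-- The homotopy class of the loop given by `l_t`. -/
def generator (I : TwoSidedIdeal (PathAlgebra k (ChainVertex n))) (v : ChainVertex n) (t : Fin n) :
    FundamentalGroupBQ I v :=
  arrowClass I tree v (arrowL t)

/-- The arrows $r_j$ and $a_j$ are the last steps of tree walks, so their classes are trivial and
only the $l_j$ survive. -/
theorem arrowClass_tree {x y : ChainVertex n} (α : ChainArrow n x y) :
    arrowClass I tree v (x := x) (y := y) α = arrowWeight (generator I v) (x := x) (y := y) α := by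
  cases α with
  | r j => exact arrowClass_eq_one tree v (arrowR j) rfl
  | l j => rfl
  | a j => exact arrowClass_eq_one tree v (arrowA j) rfl

theorem arrowClass_tree_eq :
    @arrowClass (ChainVertex n) _ k _ _ I _ tree v = @arrowWeight n _ _ (generator I v) := by
  funext x y α
  exact arrowClass_tree v α

/-- Turns a homotopy of paths into a relation between the generators of the fundamental group. -/
theorem weight_eq_of_homotopic {x y : ChainVertex n} {p q : Quiver.Path x y}
    (h : Homotopic I p.toWalk q.toWalk) :
    Quiver.Path.weight (arrowWeight (generator I v)) p =
      Quiver.Path.weight (arrowWeight (generator I v)) q := by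
  have h := loopClass_congr tree v h
  have hp := loopClass_toWalk (I := I) tree v p
  have hq := loopClass_toWalk (I := I) tree v q
  rw [arrowClass_tree_eq] at hp hq
  exact hp.symm.trans (h.trans hq)

theorem mk_eq_walkWeight (u : Walk (V := ChainVertex n) v v) :
    (Quotient.mk (homotopySetoid I v) u : FundamentalGroupBQ I v) =
      walkWeight (arrowWeight (generator I v)) u := by
  refine (loopClass_closed (I := I) tree v u).symm.trans
    ((loopClass_eq_walkWeight tree v u).trans ?_)
  rw [arrowClass_tree_eq]

theorem subsingleton_fundamentalGroup (h : ∀ t, generator I v t = 1) :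
    Subsingleton (FundamentalGroupBQ I v) := by
  have key : ∀ {x y : Quiver.Symmetrify (ChainVertex n)} (u : Walk x y),
      walkWeight (arrowWeight (generator I v)) u = 1 := by
    have hα : ∀ {x y : ChainVertex n} (α : ChainArrow n x y),
        arrowWeight (generator I v) (x := x) (y := y) α = 1 := by
      intro x y α
      cases α with
      | r j => rfl
      | l j => exact h j
      | a j => rfl
    intro x y u
    induction u with
    | nil => exact walkWeight_nil _ _
    | cons p α ih =>
      rw [walkWeight_cons, ih, one_mul]
      rcases α with α | α
      · exact hα α
      · exact inv_eq_one.2 (hα α)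
  refine subsingleton_of_forall_eq 1 ?_
  rintro ⟨u⟩
  exact (mk_eq_walkWeight v u).trans (key u)

end

end Chain

/-! ### Characters and the fundamental group of the lasso ideal -/

namespace LassoData

open PathAlgebra Chain

variable {n : ℕ} (L : LassoData n)

/-- No two generators which are identified belong to the same block. -/
def CrossesSeparated : Prop :=
  ∀ p ∈ L.crosses, ∀ q ∈ L.lassos, q.1 ≤ p.1 → ¬ p.2 ≤ q.2

/-- Scalars `μ_t` such that `a_t ↦ 1`, `A_t ↦ μ_t` annihilates all lassos and cross-lassos. -/
structure IsCharacter {k : Type u} [Field k] (μ : Fin n → k) : Prop where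
  ne_zero : ∀ t, μ t ≠ 0
  prod_eq : ∀ p ∈ L.lassos, ((block p.1 p.2).map μ).prod = -1
  add_eq : ∀ p ∈ L.crosses, μ p.1 + μ p.2 = 0

variable (k : Type u) [Field k]

/-- The lassos and cross-lassos. -/
def idealGenerators : Set (PathAlgebra k (ChainVertex n)) :=
  {f | ∃ p ∈ L.lassos, f = lasso k p.1 p.2} ∪ {f | ∃ p ∈ L.crosses, f = crossLasso k p.1 p.2}

variable {k} in
theorem exists_eq_ofPath_add {g : PathAlgebra k (ChainVertex n)} (hg : g ∈ L.idealGenerators k) :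
    (∃ p ∈ L.lassos, ∃ h : p.1 ≤ p.2, g = ofPath k (word (fun _ => false) h) +
      ofPath k (word (fun _ => true) h)) ∨
    (∃ p ∈ L.crosses, ∃ h : p.1 ≤ p.2, g = ofPath k (word (fun s => decide (s = p.2)) h) +
      ofPath k (word (fun s => decide (s = p.1)) h)) := by
  rcases hg with ⟨p, hp, rfl⟩ | ⟨p, hp, rfl⟩
  · exact Or.inl ⟨p, hp, (L.lassos_lt p hp).le, lasso_eq k (L.lassos_lt p hp)⟩
  · exact Or.inr ⟨p, hp, (L.crosses_lt p hp).le, crossLasso_eq k (L.crosses_lt p hp)⟩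

/-- The path $a_i\cdots a_j$ has weight $1$, the path $A_i\cdots A_j$ the product over the block,
and a word with the single $A_t$ the weight $m_t$. So equality of weights in each generator is
exactly the group relation. -/
theorem ideal_homogeneous {M : Type*} [Monoid M] (m : Fin n → M)
    (hl : ∀ p ∈ L.lassos, ((block p.1 p.2).map m).prod = 1) (hc : ∀ p ∈ L.crosses, m p.1 = m p.2) :
    ∀ g ∈ L.idealGenerators k, ∃ (x y : ChainVertex n) (u v : Quiver.Path x y),
      Quiver.Path.weight (arrowWeight m) u = Quiver.Path.weight (arrowWeight m) v ∧
        g = ofPath k u + ofPath k v := by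
  intro g hg
  rcases L.exists_eq_ofPath_add hg with ⟨p, hp, h, rfl⟩ | ⟨p, hp, h, rfl⟩
  · refine ⟨_, _, _, _, ?_, rfl⟩
    rw [weight_word_false, weight_word_true, hl p hp]
  · refine ⟨_, _, _, _, ?_, rfl⟩
    rw [weight_word_single m h h le_rfl, weight_word_single m h le_rfl h, hc p hp]

variable {k} in
/-- The linear functional given by the weights `μ` of paths vanishes on the ideal. -/
theorem ofPath_notMem_ideal {μ : Fin n → k} (hμ : L.IsCharacter μ) {x y : ChainVertex n}
    (p : Quiver.Path x y) (hp : Quiver.Path.weight (arrowWeight μ) p ≠ 0) :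
    ofPath k p ∉ L.ideal k := by
  let ψ : PathAlgebra k (ChainVertex n) →ₗ[k] k :=
    liftLin fun q => Quiver.Path.weight (arrowWeight μ) q.2.2
  have hψ : ∀ {x y : ChainVertex n} (q : Quiver.Path x y),
      ψ (ofPath k q) = Quiver.Path.weight (arrowWeight μ) q := fun q => liftLin_ofPath _ q
  -- Weights are multiplicative, so a product $p(u+v)q$ takes the value of $u+v$ times those of $p$
  -- and $q$, or `0` if the paths do not compose.
  have hadd : ∀ {x y z t x' y' : ChainVertex n} (p : Quiver.Path x y) (q : Quiver.Path z t)
      (u v : Quiver.Path x' y'), Quiver.Path.weight (arrowWeight μ) u +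
        Quiver.Path.weight (arrowWeight μ) v = 0 →
      ψ (ofPath k p * (ofPath k u + ofPath k v) * ofPath k q) = 0 := by
    intro x y z t x' y' p q u v huv
    by_cases h1 : y = x'
    · subst h1
      by_cases h2 : y' = z
      · subst h2
        rw [mul_add, add_mul, ofPath_mul_ofPath, ofPath_mul_ofPath, ofPath_mul_ofPath,
          ofPath_mul_ofPath, map_add, hψ, hψ, Quiver.Path.weight_comp, Quiver.Path.weight_comp,
          Quiver.Path.weight_comp, Quiver.Path.weight_comp, ← add_mul, ← mul_add, huv, mul_zero,
          zero_mul]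
      · rw [mul_assoc, add_mul, ofPath_mul_ofPath_of_ne _ _ h2, ofPath_mul_ofPath_of_ne _ _ h2,
          add_zero, mul_zero, map_zero]
    · rw [mul_add, ofPath_mul_ofPath_of_ne _ _ h1, ofPath_mul_ofPath_of_ne _ _ h1,
        add_zero, zero_mul, map_zero]
  intro hmem
  refine hp ?_
  rw [← hψ]
  refine mem_of_mem_span hmem (LinearMap.ker ψ) ?_
  intro g hg x y z t p q
  rw [LinearMap.mem_ker]
  rcases L.exists_eq_ofPath_add hg with ⟨r, hr, h, rfl⟩ | ⟨r, hr, h, rfl⟩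
  · refine hadd p q _ _ ?_
    rw [weight_word_false, weight_word_true, hμ.prod_eq r hr, add_neg_cancel]
  · refine hadd p q _ _ ?_
    rw [weight_word_single μ h h le_rfl, weight_word_single μ h le_rfl h, add_comm,
      hμ.add_eq r hr]

variable {k} in
-- The path $a_i\cdots a_j$ has value $1$ under the character, hence is not in the ideal, and the
-- two terms of the lasso are homotopic.
theorem generator_prod_eq_one {μ : Fin n → k} (hμ : L.IsCharacter μ) (v : ChainVertex n)
    {p : Fin n × Fin n} (hp : p ∈ L.lassos) :
    ((block p.1 p.2).map (generator (L.ideal k) v)).prod = 1 := by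
  have h := (L.lassos_lt p hp).le
  have hmem : ofPath k (word (fun _ => false) h) + ofPath k (word (fun _ => true) h) ∈
      L.ideal k := by
    rw [← lasso_eq k (L.lassos_lt p hp)]
    exact TwoSidedIdeal.subset_span (Or.inl ⟨p, hp, rfl⟩)
  have hh := Homotopic.of_add_mem hmem (L.ofPath_notMem_ideal hμ _ (by
    rw [weight_word_false]; exact one_ne_zero))
  have e := weight_eq_of_homotopic v hh
  rw [weight_word_false, weight_word_true] at e
  exact e.symm

variable {k} in
-- The same argument for cross-lassos; the word with the single $A_j$ has value $\mu_j$, which is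
-- where $\mu_j\neq0$ enters.
theorem generator_eq {μ : Fin n → k} (hμ : L.IsCharacter μ) (v : ChainVertex n)
    {p : Fin n × Fin n} (hp : p ∈ L.crosses) :
    generator (L.ideal k) v p.1 = generator (L.ideal k) v p.2 := by
  have h := (L.crosses_lt p hp).le
  have hmem : ofPath k (word (fun s => decide (s = p.2)) h) +
      ofPath k (word (fun s => decide (s = p.1)) h) ∈ L.ideal k := by
    rw [← crossLasso_eq k (L.crosses_lt p hp)]
    exact TwoSidedIdeal.subset_span (Or.inr ⟨p, hp, rfl⟩)
  have hh := Homotopic.of_add_mem hmem (L.ofPath_notMem_ideal hμ _ (by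
    rw [weight_word_single μ h h le_rfl]; exact hμ.ne_zero _))
  have e := weight_eq_of_homotopic v hh
  rw [weight_word_single _ h h le_rfl, weight_word_single _ h le_rfl h] at e
  exact e.symm

theorem lift_relators_eq_one {G : Type*} [Group G] (f : Fin n → G)
    (hl : ∀ p ∈ L.lassos, ((block p.1 p.2).map f).prod = 1) (hc : ∀ p ∈ L.crosses, f p.1 = f p.2) :
    ∀ r ∈ L.relators, FreeGroup.lift f r = 1 := by
  rintro r (⟨p, hp, rfl⟩ | ⟨p, hp, rfl⟩)
  · rw [map_list_prod, List.map_map, ← hl p hp]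
    congr 2
    funext t
    exact FreeGroup.lift_apply_of
  · rw [map_mul, map_inv, FreeGroup.lift_apply_of, FreeGroup.lift_apply_of, hc p hp, mul_inv_cancel]

theorem prod_of_eq_one {p : Fin n × Fin n} (hp : p ∈ L.lassos) :
    ((block p.1 p.2).map (PresentedGroup.of (rels := L.relators))).prod = 1 := by
  have h := PresentedGroup.one_of_mem (rels := L.relators) (Or.inl ⟨p, hp, rfl⟩)
  rw [map_list_prod, List.map_map] at h
  exact h

theorem of_eq_of {p : Fin n × Fin n} (hp : p ∈ L.crosses) :
    PresentedGroup.of (rels := L.relators) p.1 = PresentedGroup.of p.2 :=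
  PresentedGroup.mk_eq_mk_of_mul_inv_mem (Or.inr ⟨p, hp, rfl⟩)

theorem map_walkWeight {V G K : Type*} [Quiver V] [Group G] [Group K]
    (w : ∀ {x y : V}, (x ⟶ y) → G) (F : G →* K) {x y : Quiver.Symmetrify V} (u : Walk x y) :
    F (walkWeight w u) = walkWeight (fun α => F (w α)) u := by
  induction u with
  | nil => rw [walkWeight_nil, walkWeight_nil, map_one]
  | cons p α ih =>
    rw [walkWeight_cons, walkWeight_cons, map_mul, ih]
    congr 1
    rcases α with α | α
    · rfl
    · exact map_inv F _

theorem map_arrowWeight {G K : Type*} [Group G] [Group K] (m : Fin n → G) (F : G →* K)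
    {x y : ChainVertex n} (α : ChainArrow n x y) :
    F (arrowWeight m (x := x) (y := y) α) =
      arrowWeight (fun t => F (m t)) (x := x) (y := y) α := by
  cases α with
  | r j => exact map_one F
  | l j => rfl
  | a j => exact map_one F

variable {k} in
/-- The fundamental group of the ideal is presented by the relators. -/
theorem nonempty_fundamentalGroup_equiv {μ : Fin n → k} (hμ : L.IsCharacter μ)
    (v : ChainVertex n) :
    Nonempty (FundamentalGroupBQ (L.ideal k) v ≃* PresentedGroup L.relators) := by
  let w : Fin n → PresentedGroup L.relators := PresentedGroup.of
  have hw : ∀ {x y : Quiver.Symmetrify (ChainVertex n)} (u u' : Walk x y),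
      Homotopic (L.ideal k) u u' →
        walkWeight (arrowWeight w) u = walkWeight (arrowWeight w) u' :=
    fun u u' h => Homotopic.walkWeight_eq (arrowWeight w)
      (L.ideal_homogeneous k w (fun p hp => L.prod_of_eq_one hp) (fun p hp => L.of_eq_of hp)) h
  let F : FundamentalGroupBQ (L.ideal k) v →* PresentedGroup L.relators :=
    MonoidHom.mk' (Quotient.lift (fun u => walkWeight (arrowWeight w) u) fun u u' h => hw u u' h)
      (by
        rintro ⟨u⟩ ⟨u'⟩
        exact walkWeight_comp (arrowWeight w) u u')
  let E : PresentedGroup L.relators →* FundamentalGroupBQ (L.ideal k) v :=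
    PresentedGroup.toGroup (f := generator (L.ideal k) v) (L.lift_relators_eq_one _
      (fun p hp => L.generator_prod_eq_one hμ v hp) (fun p hp => L.generator_eq hμ v hp))
  have hE : ∀ t, E (w t) = generator (L.ideal k) v t := fun t => PresentedGroup.toGroup.of _
  refine ⟨MonoidHom.toMulEquiv F E ?_ ?_⟩
  -- `E` carries the weight of a walk in the presented group to its weight in the `generator`s,
  -- which is its homotopy class.
  · refine MonoidHom.ext ?_
    rintro ⟨u⟩
    change E (walkWeight (arrowWeight w) u) = Quotient.mk (homotopySetoid (L.ideal k) v) u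
    rw [mk_eq_walkWeight]
    refine (map_walkWeight (arrowWeight w) E u).trans ?_
    have e : (fun {x y : ChainVertex n} (α : x ⟶ y) => E (arrowWeight w α)) =
        @arrowWeight n _ _ (generator (L.ideal k) v) := by
      funext x y α
      refine (map_arrowWeight w E α).trans ?_
      rw [funext hE]
    exact congrArg (fun ω : ∀ x y : ChainVertex n, (x ⟶ y) → FundamentalGroupBQ (L.ideal k) v =>
      walkWeight (fun {x y} α => ω x y α) u) e
  · refine PresentedGroup.ext fun t => ?_
    change F (E (w t)) = w t
    rw [hE]
    -- The tree walks have trivial weight, so the loop around $l_t$ has the weight of $l_t$.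
    refine (walkWeight_loopAt tree v (arrowWeight w) (walkWeight_tree w)
      (Quiver.Hom.toPath (V := Quiver.Symmetrify (ChainVertex n))
        (@Quiver.Hom.toPos (ChainVertex n) _ _ _ (arrowL t)))).trans ?_
    exact walkWeight_toPath (arrowWeight w) _

/-! ### The transvected ideal -/

/-- The image of the ideal under the product of the transvections. -/
noncomputable def sheared : TwoSidedIdeal (PathAlgebra k (ChainVertex n)) :=
  TwoSidedIdeal.comap (shearAll k n).symm (L.ideal k)

variable {k} in
theorem mem_sheared {f : PathAlgebra k (ChainVertex n)} :
    f ∈ L.sheared k ↔ (shearAll k n).symm f ∈ L.ideal k :=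
  TwoSidedIdeal.mem_comap _

theorem coe_sheared : (L.sheared k : Set (PathAlgebra k (ChainVertex n))) =
    shearAll k n '' (L.ideal k : Set (PathAlgebra k (ChainVertex n))) := by
  ext f
  constructor
  · intro hf
    exact ⟨(shearAll k n).symm f, L.mem_sheared.1 hf, AlgEquiv.apply_symm_apply _ _⟩
  · rintro ⟨g, hg, rfl⟩
    refine L.mem_sheared.2 ?_
    rw [AlgEquiv.symm_apply_apply]
    exact hg

variable {L k} in
/-- Between the end points of a block, the ideal consists of the multiples of the lasso. -/
theorem exists_vertex_mul_eq (hL : L.CrossesSeparated) {i j : Fin n} (hij : (i, j) ∈ L.lassos)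
    {f : PathAlgebra k (ChainVertex n)} (hf : f ∈ L.ideal k) :
    ∃ c : k, vertex k (ChainVertex.x i.castSucc) * f * vertex k (ChainVertex.x j.succ) =
      c • lasso k i j := by
  let T : PathAlgebra k (ChainVertex n) →ₗ[k] PathAlgebra k (ChainVertex n) :=
    LinearMap.mulRight k (vertex k (ChainVertex.x j.succ)) ∘ₗ
      LinearMap.mulLeft k (vertex k (ChainVertex.x i.castSucc))
  have hT : ∀ g, T g =
      vertex k (ChainVertex.x i.castSucc) * g * vertex k (ChainVertex.x j.succ) := fun _ => rfl
  have key : f ∈ (Submodule.span k {lasso k i j}).comap T := by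
    refine mem_of_mem_span (s := L.idealGenerators k) hf _ fun g hg {x y z t} p q => ?_
    rw [Submodule.mem_comap, hT]
    by_cases hx : ChainVertex.x i.castSucc = x
    swap
    · rw [← mul_assoc, ← mul_assoc, vertex, ofPath_mul_ofPath_of_ne _ _ hx, zero_mul, zero_mul,
        zero_mul]
      exact Submodule.zero_mem _
    by_cases ht : t = ChainVertex.x j.succ
    swap
    · rw [mul_assoc, mul_assoc _ (ofPath k q), vertex, vertex, ofPath_mul_ofPath_of_ne _ _ ht,
        mul_zero, mul_zero]
      exact Submodule.zero_mem _
    subst hx ht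
    rw [← mul_assoc, ← mul_assoc, vertex_mul, mul_assoc, mul_vertex]
    -- By heights, a generator from $x_{i'}$ to $x_{j'+1}$ contributes only if
    -- $[i',j']\subseteq[i,j]$. The hypothesis asks that it then be the lasso itself, and acyclicity
    -- makes `p` and `q` stationary.
    have main : ∀ (i' j' : Fin n) (u v : Quiver.Path (ChainVertex.x i'.castSucc : ChainVertex n)
        (ChainVertex.x j'.succ)), g = ofPath k u + ofPath k v →
        (i ≤ i' → j' ≤ j → (i', j') = (i, j) ∧ g = lasso k i j) →
        ofPath k p * g * ofPath k q ∈ Submodule.span k {lasso k i j} := by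
      intro i' j' u v hg h
      by_cases hy : y = ChainVertex.x i'.castSucc
      swap
      · rw [hg, mul_add, ofPath_mul_ofPath_of_ne _ _ hy, ofPath_mul_ofPath_of_ne _ _ hy,
          add_zero, zero_mul]
        exact Submodule.zero_mem _
      by_cases hz : ChainVertex.x j'.succ = z
      swap
      · rw [hg, mul_assoc, add_mul, ofPath_mul_ofPath_of_ne _ _ hz, ofPath_mul_ofPath_of_ne _ _ hz,
          add_zero, mul_zero]
        exact Submodule.zero_mem _
      subst hy hz
      have h1 := height_add_length_le p
      have h2 := height_add_length_le q
      simp only [height, Fin.val_castSucc, Fin.val_succ] at h1 h2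
      obtain ⟨e, rfl⟩ := h (by rw [Fin.le_def]; omega) (by rw [Fin.le_def]; omega)
      obtain ⟨rfl, rfl⟩ := Prod.mk.inj e
      rw [isAcyclicQuiver _ p, isAcyclicQuiver _ q, hg, mul_add, add_mul]
      change vertex k _ * _ * vertex k _ + vertex k _ * _ * vertex k _ ∈ _
      rw [vertex_mul, vertex_mul, mul_vertex, mul_vertex, ← hg]
      exact Submodule.mem_span_singleton_self _
    rcases hg with ⟨⟨i', j'⟩, hp, rfl⟩ | ⟨⟨i', j'⟩, hp, rfl⟩
    · refine main i' j' _ _ (lasso_eq k (L.lassos_lt _ hp)) fun h1 h2 => ?_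
      have hlt' : i' < j' := L.lassos_lt _ hp
      -- Both lasso intervals contain `i'`, so they coincide.
      have e := (L.partition i').unique (y₁ := (i', j')) (y₂ := (i, j))
        ⟨hp, le_rfl, hlt'.le⟩ ⟨hij, h1, hlt'.le.trans h2⟩
      obtain ⟨rfl, rfl⟩ := Prod.mk.inj e
      exact ⟨rfl, rfl⟩
    · refine main i' j' _ _ (crossLasso_eq k (L.crosses_lt _ hp)) fun h1 h2 => ?_
      exact absurd h2 (hL _ hp _ hij h1)
  rw [Submodule.mem_comap, hT] at key
  obtain ⟨c, hc⟩ := Submodule.mem_span_singleton.1 key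
  exact ⟨c, hc.symm⟩

variable {L} in
-- Within the block of `t` the image of the lasso is the only relation up to scalars. It contains
-- both $a_i\cdots a_j$ and the word with the single $A_t$, whose weights are $1$ and $w_t$.
theorem subsingleton_fundamentalGroup_sheared (hL : L.CrossesSeparated) (v : ChainVertex n) :
    Subsingleton (FundamentalGroupBQ (L.sheared k) v) := by
  refine subsingleton_fundamentalGroup v fun t => ?_
  obtain ⟨⟨i, j⟩, ⟨hij, hi, hj⟩, -⟩ := L.partition t
  have hlt : i < j := L.lassos_lt _ hij
  have hmem : shearAll k n (lasso k i j) ∈ L.sheared k := by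
    rw [mem_sheared, AlgEquiv.symm_apply_apply]
    exact TwoSidedIdeal.subset_span (Or.inl ⟨(i, j), hij, rfl⟩)
  have hloc : vertex k (ChainVertex.x i.castSucc) * shearAll k n (lasso k i j) *
      vertex k (ChainVertex.x j.succ) = shearAll k n (lasso k i j) := by
    conv_lhs => rw [← shearAll_vertex k (ChainVertex.x i.castSucc),
      ← shearAll_vertex k (ChainVertex.x j.succ), ← map_mul, ← map_mul]
    rw [lasso_eq k hlt, mul_add, add_mul, vertex_mul, vertex_mul, mul_vertex, mul_vertex]
  have huniq : ∀ f ∈ L.sheared k, ∃ c : k, vertex k (ChainVertex.x i.castSucc) * f *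
      vertex k (ChainVertex.x j.succ) = c • shearAll k n (lasso k i j) := by
    intro f hf
    obtain ⟨c, hc⟩ := exists_vertex_mul_eq hL hij (L.mem_sheared.1 hf)
    refine ⟨c, ?_⟩
    have h := congrArg (shearAll k n) hc
    rwa [map_mul, map_mul, shearAll_vertex, shearAll_vertex, AlgEquiv.apply_symm_apply,
      map_smul] at h
  have hcoeff : ∀ (ε : Fin n → Bool) (s : Fin n), i ≤ s → s ≤ j → ε s = false →
      coeff ⟨_, _, word ε hlt.le⟩ (shearAll k n (lasso k i j)) ≠ 0 := by
    intro ε s h1 h2 hs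
    rw [shearAll_lasso, coeff_word_image_lasso k hlt.le h1 h2 hs]
    exact one_ne_zero
  -- A second index of the block, available because blocks have length at least two. It keeps both
  -- words away from $A_i\cdots A_j$, whose coefficient $2$ vanishes in characteristic two.
  obtain ⟨s, hs, his, hsj⟩ : ∃ s, s ≠ t ∧ i ≤ s ∧ s ≤ j := by
    by_cases h : t = i
    · exact ⟨j, by rw [h]; exact hlt.ne', hlt.le, le_rfl⟩
    · exact ⟨i, Ne.symm h, le_rfl, hlt.le⟩
  have hh := Homotopic.of_unique_relation hmem hloc huniq
    (hcoeff (fun s => decide (s = t)) s his hsj (by simpa using hs))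
    (hcoeff (fun _ => false) s his hsj rfl)
  have e := weight_eq_of_homotopic v hh
  rwa [weight_word_single _ hlt.le hi hj, weight_word_false] at e

/-! ### Admissibility -/

theorem ideal_le_lengthFiltration {f : PathAlgebra k (ChainVertex n)} (hf : f ∈ L.ideal k) :
    f ∈ lengthFiltration k (ChainVertex n) 2 := by
  refine span_le_lengthFiltration ?_ hf
  have hlen : ∀ {i j : Fin n} (h : i < j) (ε : Fin n → Bool),
      ofPath k (word ε h.le) ∈ lengthFiltration k (ChainVertex n) 2 := by
    intro i j h ε
    have hstep : ∀ t, (if ε t then A k t else a k t) ∈ lengthFiltration k (ChainVertex n) 1 := by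
      intro t
      split_ifs
      · exact ofPath_mem_lengthFiltration _ one_le_two
      · exact ofPath_mem_lengthFiltration _ le_rfl
    rw [ofPath_word, block_eq_between h, List.map_cons, List.prod_cons, List.map_append,
      List.prod_append, List.map_singleton, List.prod_singleton]
    exact mul_mem_lengthFiltration (m := 1) (m' := 0 + 1) (hstep i)
      (mul_mem_lengthFiltration (mem_lengthFiltration_zero _) (hstep j))
  intro g hg
  rcases hg with ⟨p, hp, rfl⟩ | ⟨p, hp, rfl⟩
  · rw [lasso_eq k (L.lassos_lt p hp)]
    exact Submodule.add_mem _ (hlen (L.lassos_lt p hp) _) (hlen (L.lassos_lt p hp) _)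
  · rw [crossLasso_eq k (L.crosses_lt p hp)]
    exact Submodule.add_mem _ (hlen (L.crosses_lt p hp) _) (hlen (L.crosses_lt p hp) _)

theorem path_length_lt {x y : ChainVertex n} (p : Quiver.Path x y) : p.length < 2 * n + 1 := by
  have h1 := height_add_length_le p
  have h2 := height_le y
  omega

theorem isAdmissible_ideal : IsAdmissible (L.ideal k) :=
  isAdmissible_of_length_lt _ path_length_lt fun _ hf => L.ideal_le_lengthFiltration k hf

theorem isAdmissible_sheared : IsAdmissible (L.sheared k) := by
  refine isAdmissible_of_length_lt _ path_length_lt fun f hf => ?_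
  have h := map_mem_lengthFiltration (shearAll k n).toAlgHom (shearAll_ofArrow_mem k)
    (L.ideal_le_lengthFiltration k (L.mem_sheared.1 hf))
  have e : (shearAll k n).toAlgHom ((shearAll k n).symm f) = f := AlgEquiv.apply_symm_apply _ _
  rwa [e] at h

/-- Both ideals are the kernels of presentations of the same triangular algebra. -/
theorem exists_presentations : ∃ (A : Type u) (_ : Ring A) (_ : Algebra k A),
    IsTriangularAlgebra k A ∧ IsPresentation (L.ideal k) A ∧ IsPresentation (L.sheared k) A := by
  let ν : PathAlgebra k (ChainVertex n) →ₐ[k] (L.ideal k).ringCon.Quotient :=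
    { (L.ideal k).ringCon.mk' with commutes' := fun _ => rfl }
  have hν : Function.Surjective ν := Quotient.mk_surjective
  have hker : TwoSidedIdeal.ker ν = L.ideal k := TwoSidedIdeal.ker_ringCon_mk' _
  have h1 : IsPresentation (L.ideal k) (L.ideal k).ringCon.Quotient :=
    ⟨isFiniteConnectedQuiver, L.isAdmissible_ideal k, ν, hν, hker⟩
  refine ⟨(L.ideal k).ringCon.Quotient, inferInstance, inferInstance,
    ⟨ChainVertex n, inferInstance, inferInstance, L.ideal k, isAcyclicQuiver, h1⟩, h1,
    isFiniteConnectedQuiver, L.isAdmissible_sheared k,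
    -- The same algebra is reached by undoing the transvections before passing to the quotient.
    ν.comp (shearAll k n).symm.toAlgHom, ?_, ?_⟩
  · exact hν.comp (shearAll k n).symm.surjective
  · refine TwoSidedIdeal.ext fun f => ?_
    have h := TwoSidedIdeal.ext_iff.1 hker ((shearAll k n).symm f)
    rw [mem_sheared, ← h, TwoSidedIdeal.mem_ker, TwoSidedIdeal.mem_ker]
    rfl

end LassoData

namespace LassoData

open PathAlgebra Chain

/-! ### Consecutive blocks -/

section Blocks

variable {K : Type} [LinearOrder K] [Fintype K] (len : K → ℕ)

/-- The positions in a family of blocks, in lexicographic order. -/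
abbrev Position := Σₗ b : K, Fin (len b)

/-- The number of positions. -/
def total : ℕ := Fintype.card (Position len)

/-- The enumeration of the positions in lexicographic order. -/
noncomputable def positionIso : Fin (total len) ≃o Position len :=
  Fintype.orderIsoFinOfCardEq (Position len) rfl

/-- The index of a position. -/
noncomputable def pos (b : K) (j : Fin (len b)) : Fin (total len) :=
  (positionIso len).symm (toLex ⟨b, j⟩)

/-- The block of an index. -/
noncomputable def blockOf (t : Fin (total len)) : K := (ofLex (positionIso len t)).1

variable {len}

theorem exists_eq_pos (t : Fin (total len)) : ∃ j, t = pos len (blockOf len t) j :=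
  ⟨(ofLex (positionIso len t)).2, ((positionIso len).symm_apply_apply t).symm⟩

theorem blockOf_pos (b : K) (j : Fin (len b)) : blockOf len (pos len b j) = b := by
  rw [blockOf, pos, OrderIso.apply_symm_apply]; rfl

theorem pos_le_pos {b b' : K} {j : Fin (len b)} {j' : Fin (len b')} :
    pos len b j ≤ pos len b' j' ↔ b < b' ∨ ∃ h : b = b', h.rec j ≤ j' := by
  rw [pos, pos, OrderIso.le_iff_le, Sigma.Lex.le_def]; rfl

theorem pos_le_pos_same {b : K} {j j' : Fin (len b)} :
    pos len b j ≤ pos len b j' ↔ j ≤ j' := by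
  rw [pos_le_pos]; simp

theorem pos_injective (b : K) : Function.Injective (pos len b) := fun _ _ h =>
  le_antisymm (pos_le_pos_same.1 h.le) (pos_le_pos_same.1 h.ge)

theorem lt_of_blockOf_lt {t t' : Fin (total len)} (h : blockOf len t < blockOf len t') :
    t < t' := by
  rw [← not_le]
  obtain ⟨j, e⟩ := exists_eq_pos t
  obtain ⟨j', e'⟩ := exists_eq_pos t'
  intro hle
  rw [e, e', pos_le_pos] at hle
  rcases hle with h' | ⟨h', -⟩
  · exact lt_asymm h h'
  · exact h.ne' h'

variable (len) in
/-- The first and the last index of a block. -/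
noncomputable def ends (hlen : ∀ b, 2 ≤ len b) (b : K) : Fin (total len) × Fin (total len) :=
  (pos len b ⟨0, by have := hlen b; omega⟩, pos len b ⟨len b - 1, by have := hlen b; omega⟩)

/-- In the lexicographic order each block is an interval. This yields the partition property of the
lassos. -/
theorem mem_ends {hlen : ∀ b, 2 ≤ len b} {b : K} {t : Fin (total len)} :
    (ends len hlen b).1 ≤ t ∧ t ≤ (ends len hlen b).2 ↔ blockOf len t = b := by
  constructor
  · rintro ⟨h1, h2⟩
    by_contra hne
    have e1 : blockOf len (ends len hlen b).1 = b := blockOf_pos _ _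
    have e2 : blockOf len (ends len hlen b).2 = b := blockOf_pos _ _
    rcases lt_or_gt_of_ne hne with h | h
    · exact absurd h1 (not_le.2 (lt_of_blockOf_lt (by rwa [e1])))
    · exact absurd h2 (not_le.2 (lt_of_blockOf_lt (by rwa [e2])))
  · rintro rfl
    obtain ⟨j, e⟩ := exists_eq_pos t
    rw [ends]
    constructor
    · conv_rhs => rw [e]
      rw [pos_le_pos_same, Fin.le_def]
      exact Nat.zero_le _
    · conv_lhs => rw [e]
      rw [pos_le_pos_same, Fin.le_def]
      have := j.2
      simp only
      omega

theorem block_ends {hlen : ∀ b, 2 ≤ len b} (b : K) :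
    block (ends len hlen b).1 (ends len hlen b).2 = List.ofFn (pos len b) := by
  refine List.Pairwise.eq_of_mem_iff (r := (· < ·)) (pairwise_block _ _) ?_ fun t => ?_
  · rw [List.pairwise_ofFn]
    intro j j' h
    exact lt_of_le_of_ne (pos_le_pos_same.2 h.le) ((pos_injective b).ne h.ne)
  · rw [mem_block, mem_ends, List.mem_ofFn]
    constructor
    · rintro rfl
      obtain ⟨j, e⟩ := exists_eq_pos t
      exact ⟨j, e.symm⟩
    · rintro ⟨j, rfl⟩
      exact blockOf_pos b j

end Blocks

/-! ### Lassos from words -/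

section Words

variable {S : Type*} {K : Type} [LinearOrder K] [Fintype K] (B : K → List (S × Bool))

/-- The lengths of the blocks. -/
def lens (b : K) : ℕ := (B b).length

/-- The letter at an index. -/
noncomputable def letter (t : Fin (total (lens B))) : S × Bool :=
  (B (ofLex (positionIso (lens B) t)).1).get (ofLex (positionIso (lens B) t)).2

variable {B}

theorem letter_pos (b : K) (j : Fin (lens B b)) : letter B (pos (lens B) b j) = (B b).get j := by
  rw [letter, pos, OrderIso.apply_symm_apply]; rfl

/-- Transfers products over the indices of a block to products over the word written on it; used for
signs and for group elements. -/
theorem prod_block_letter {hlen : ∀ b, 2 ≤ lens B b} {M : Type*} [Monoid M] (f : S × Bool → M)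
    (b : K) : ((block (ends (lens B) hlen b).1 (ends (lens B) hlen b).2).map
      fun t => f (letter B t)).prod = ((B b).map f).prod := by
  rw [block_ends, List.map_ofFn]
  congr 1
  conv_rhs => rw [← List.ofFn_get (B b), List.map_ofFn]
  congr 1
  funext j
  exact congrArg f (letter_pos b j)

variable (B)

open Classical in
/-- The blocks are the lassos, and the letters of the blocks outside `src` are identified with the
equal letters of the blocks in `src`. -/
noncomputable def ofWords (src : K → Prop) (hsrc : ∀ b b', src b → ¬ src b' → b < b')
    (hlen : ∀ b, 2 ≤ lens B b) : LassoData (total (lens B)) where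
  lassos := Finset.univ.image (ends (lens B) hlen)
  crosses := Finset.univ.filter fun p => src (blockOf (lens B) p.1) ∧
    ¬ src (blockOf (lens B) p.2) ∧ letter B p.1 = letter B p.2
  lassos_lt := by
    intro p hp
    obtain ⟨b, -, rfl⟩ := Finset.mem_image.1 hp
    refine lt_of_le_of_ne ?_ ?_
    · rw [ends, pos_le_pos_same, Fin.le_def]
      exact Nat.zero_le _
    · refine (pos_injective b).ne fun h => ?_
      have := hlen b
      rw [Fin.ext_iff] at h
      simp only at h
      omega
  crosses_lt := by
    intro p hp
    obtain ⟨-, h1, h2, -⟩ := Finset.mem_filter.1 hp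
    exact lt_of_blockOf_lt (hsrc _ _ h1 h2)
  partition := by
    intro t
    refine ⟨ends (lens B) hlen (blockOf (lens B) t), ⟨Finset.mem_image_of_mem _ (Finset.mem_univ _),
      mem_ends.2 rfl⟩, ?_⟩
    rintro p ⟨hp, ht⟩
    obtain ⟨b, -, rfl⟩ := Finset.mem_image.1 hp
    rw [mem_ends.1 ht]

variable {B} {src : K → Prop} {hsrc : ∀ b b', src b → ¬ src b' → b < b'}
  {hlen : ∀ b, 2 ≤ lens B b}

theorem mem_lassos_ofWords {p : Fin (total (lens B)) × Fin (total (lens B))} :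
    p ∈ (ofWords B src hsrc hlen).lassos ↔ ∃ b, ends (lens B) hlen b = p := by
  classical
  simp [ofWords]

theorem mem_crosses_ofWords {p : Fin (total (lens B)) × Fin (total (lens B))} :
    p ∈ (ofWords B src hsrc hlen).crosses ↔ src (blockOf (lens B) p.1) ∧
      ¬ src (blockOf (lens B) p.2) ∧ letter B p.1 = letter B p.2 := by
  classical
  simp [ofWords]

/-- A cross-lasso joins a block in `src` to one outside; if it lay inside a lasso, its ends would
belong to the same block. -/
theorem crossesSeparated_ofWords : (ofWords B src hsrc hlen).CrossesSeparated := by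
  intro p hp q hq h1 h2
  have hlt := (ofWords B src hsrc hlen).crosses_lt p hp
  obtain ⟨b, rfl⟩ := mem_lassos_ofWords.1 hq
  obtain ⟨h3, h4, -⟩ := mem_crosses_ofWords.1 hp
  have e1 := mem_ends.1 ⟨h1, hlt.le.trans h2⟩
  have e2 := mem_ends.1 ⟨h1.trans hlt.le, h2⟩
  rw [e1] at h3
  rw [e2] at h4
  exact h4 h3

/-- The sign of a letter. -/
def letterSign (k : Type u) [Field k] (c : S × Bool) : k := if c.2 then -1 else 1

/-- The character is the sign of the letter, negated on the blocks in `src`. Crosses join equal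
letters across this division, so their values are opposite. -/
theorem exists_isCharacter_ofWords {k : Type u} [Field k]
    (hpos : ∀ b, src b → ((B b).map fun c => -letterSign k c).prod = -1)
    (hneg : ∀ b, ¬ src b → ((B b).map (letterSign k)).prod = -1) :
    ∃ μ : Fin (total (lens B)) → k, (ofWords B src hsrc hlen).IsCharacter μ := by
  classical
  have hne : ∀ c : S × Bool, letterSign k c ≠ 0 := by
    intro c
    unfold letterSign
    split_ifs
    · exact neg_ne_zero.2 one_ne_zero
    · exact one_ne_zero
  refine ⟨fun t => if src (blockOf (lens B) t) then -letterSign k (letter B t) else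
    letterSign k (letter B t), ?_, ?_, ?_⟩
  · intro t
    split_ifs
    · exact neg_ne_zero.2 (hne _)
    · exact hne _
  · intro p hp
    obtain ⟨b, rfl⟩ := mem_lassos_ofWords.1 hp
    by_cases hb : src b
    · rw [← hpos b hb, ← prod_block_letter (hlen := hlen)]
      congr 1
      refine List.map_congr_left fun t ht => ?_
      rw [if_pos]
      rwa [mem_ends.1 (mem_block.1 ht)]
    · rw [← hneg b hb, ← prod_block_letter (hlen := hlen)]
      congr 1
      refine List.map_congr_left fun t ht => ?_
      rw [if_neg]
      rwa [mem_ends.1 (mem_block.1 ht)]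
  · intro p hp
    obtain ⟨h1, h2, h3⟩ := mem_crosses_ofWords.1 hp
    rw [if_pos h1, if_neg h2, h3, neg_add_cancel]

/-- The value of a letter. -/
def letterValue {G : Type*} [Group G] (f : S → G) (c : S × Bool) : G :=
  cond c.2 (f c.1) (f c.1)⁻¹

theorem map_letterValue {G G' : Type*} [Group G] [Group G'] (F : G →* G') (f : S → G)
    (c : S × Bool) : F (letterValue f c) = letterValue (fun s => F (f s)) c := by
  rcases c with ⟨s, _ | _⟩
  · exact map_inv F _
  · rfl

/-- The source block of $s$ makes its two generators inverse to each other, and the crosses identify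
every letter of a relator block with one of these two. After this elimination the lassos of the
relator blocks are the relators in `R`. -/
theorem nonempty_equiv_ofWords (R : Set (FreeGroup S)) (σ : S → K) (hσ : ∀ s, src (σ s))
    (hσ' : ∀ b, src b → ∃ s, b = σ s) (hB : ∀ s, B (σ s) = [(s, true), (s, false)])
    (hR : ∀ b, ¬ src b → FreeGroup.mk (B b) ∈ R)
    (hR' : ∀ x ∈ R, x = 1 ∨ ∃ b, ¬ src b ∧ FreeGroup.mk (B b) = x) :
    Nonempty (PresentedGroup (ofWords B src hsrc hlen).relators ≃* PresentedGroup R) := by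
  set L := ofWords B src hsrc hlen with hL
  have h2 : ∀ s, lens B (σ s) = 2 := fun s => by rw [lens, hB]; rfl
  let p₀ : S → Fin (total (lens B)) := fun s => pos (lens B) (σ s) ⟨0, by rw [h2]; omega⟩
  let p₁ : S → Fin (total (lens B)) := fun s => pos (lens B) (σ s) ⟨1, by rw [h2]; omega⟩
  have hp₀ : ∀ s, letter B (p₀ s) = (s, true) := by
    intro s
    have h : ∀ l : List (S × Bool), l = [(s, true), (s, false)] → ∀ h : 0 < l.length,
        l.get ⟨0, h⟩ = (s, true) := by
      rintro _ rfl _; rfl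
    exact (letter_pos _ _).trans (h _ (hB s) _)
  have hp₁ : ∀ s, letter B (p₁ s) = (s, false) := by
    intro s
    have h : ∀ l : List (S × Bool), l = [(s, true), (s, false)] → ∀ h : 1 < l.length,
        l.get ⟨1, h⟩ = (s, false) := by
      rintro _ rfl _; rfl
    exact (letter_pos _ _).trans (h _ (hB s) _)
  let w : Fin (total (lens B)) → PresentedGroup L.relators := PresentedGroup.of
  have hlasso : ∀ b, ((block (ends (lens B) hlen b).1 (ends (lens B) hlen b).2).map w).prod = 1 :=
    fun b => L.prod_of_eq_one (mem_lassos_ofWords.2 ⟨b, rfl⟩)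
  have hsource : ∀ s, w (p₁ s) = (w (p₀ s))⁻¹ := by
    intro s
    have h := hlasso (σ s)
    have e : block (ends (lens B) hlen (σ s)).1 (ends (lens B) hlen (σ s)).2 = [p₀ s, p₁ s] := by
      rw [block_ends]
      refine List.ext_getElem ?_ ?_
      · rw [List.length_ofFn, h2]; rfl
      · intro i h1 h2
        rw [List.getElem_ofFn]
        have hi : i < 2 := h2
        interval_cases i <;> rfl
    rw [e, List.map_cons, List.map_singleton, List.prod_cons, List.prod_singleton] at h
    exact eq_inv_of_mul_eq_one_right h
  have hw_src : ∀ t, src (blockOf (lens B) t) →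
      w t = letterValue (fun s => w (p₀ s)) (letter B t) := by
    intro t ht
    obtain ⟨s, hs⟩ := hσ' _ ht
    obtain ⟨j, e⟩ := exists_eq_pos t
    have e' : t = p₀ s ∨ t = p₁ s := by
      generalize hb : blockOf (lens B) t = b at hs j e
      subst hs
      obtain ⟨j, hj⟩ := j
      have hj' : j < 2 := by rwa [h2] at hj
      interval_cases j
      · exact Or.inl e
      · exact Or.inr e
    rcases e' with rfl | rfl
    · rw [hp₀]; rfl
    · rw [hp₁, hsource]; rfl
  -- A letter outside the source blocks equals the one at `p₀ s` or `p₁ s` and is identified with it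
  -- by a cross.
  have hw : ∀ t, w t = letterValue (fun s => w (p₀ s)) (letter B t) := by
    intro t
    by_cases ht : src (blockOf (lens B) t)
    · exact hw_src t ht
    · have key : ∀ t', src (blockOf (lens B) t') → letter B t' = letter B t →
          w t = letterValue (fun s => w (p₀ s)) (letter B t) := by
        intro t' h1 h2
        have h3 : w t' = w t := L.of_eq_of (p := (t', t)) (mem_crosses_ofWords.2 ⟨h1, ht, h2⟩)
        rw [← h3, hw_src t' h1, h2]
      generalize hc : letter B t = c at key ⊢
      obtain ⟨s, _ | _⟩ := c
      · exact key (p₁ s) (by rw [blockOf_pos]; exact hσ s) (hp₁ s)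
      · exact key (p₀ s) (by rw [blockOf_pos]; exact hσ s) (hp₀ s)
  have hval : ∀ b, ((B b).map (letterValue (PresentedGroup.of (rels := R)))).prod =
      PresentedGroup.mk R (FreeGroup.mk (B b)) := by
    intro b
    have h : PresentedGroup.mk R = FreeGroup.lift (PresentedGroup.of (rels := R)) := by
      ext s; rw [FreeGroup.lift_apply_of]; rfl
    rw [h, FreeGroup.lift_mk]
    rfl
  let F : PresentedGroup L.relators →* PresentedGroup R :=
    PresentedGroup.toGroup (f := fun t => letterValue PresentedGroup.of (letter B t))
      (L.lift_relators_eq_one _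
        (by
          intro p hp
          obtain ⟨b, rfl⟩ := mem_lassos_ofWords.1 hp
          rw [prod_block_letter]
          by_cases hb : src b
          · obtain ⟨s, rfl⟩ := hσ' b hb
            rw [hB]
            exact (List.prod_cons.trans (congrArg _ List.prod_singleton)).trans
              (mul_inv_cancel (PresentedGroup.of (rels := R) s))
          · rw [hval]
            exact PresentedGroup.one_of_mem (hR b hb))
        (by
          intro p hp
          rw [(mem_crosses_ofWords.1 hp).2.2]))
  let E : PresentedGroup R →* PresentedGroup L.relators :=
    PresentedGroup.toGroup (f := fun s => w (p₀ s)) (by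
      intro x hx
      rcases hR' x hx with rfl | ⟨b, -, rfl⟩
      · exact map_one _
      · rw [FreeGroup.lift_mk, ← hlasso b]
        refine (prod_block_letter (hlen := hlen) (letterValue fun s => w (p₀ s)) b).symm.trans ?_
        congr 2
        funext t
        exact (hw t).symm)
  have hF : ∀ t, F (w t) = letterValue PresentedGroup.of (letter B t) :=
    fun t => PresentedGroup.toGroup.of _
  have hE : ∀ s, E (PresentedGroup.of s) = w (p₀ s) := fun s => PresentedGroup.toGroup.of _
  refine ⟨MonoidHom.toMulEquiv F E ?_ ?_⟩
  · refine PresentedGroup.ext fun t => ?_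
    change E (F (w t)) = w t
    rw [hF, map_letterValue, hw t, funext hE]
  · refine PresentedGroup.ext fun s => ?_
    change F (E (PresentedGroup.of s)) = PresentedGroup.of s
    rw [hE, hF, hp₀]
    rfl

end Words

/-! ### Presentations by lassos -/

/-- The sign product is $\pm1$, and appending $ss^{-1}$ changes its sign without changing the
element. The assumption `x ≠ 1` provides the letter `s`. -/
theorem exists_word {S : Type*} (k : Type u) [Field k] (x : FreeGroup S) (hx : x ≠ 1) :
    ∃ l : List (S × Bool), FreeGroup.mk l = x ∧ 2 ≤ l.length ∧
      (l.map (letterSign k)).prod = -1 := by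
  classical
  obtain ⟨l, rfl⟩ : ∃ l, FreeGroup.mk l = x := ⟨x.toWord, FreeGroup.mk_toWord⟩
  obtain ⟨s⟩ : Nonempty S := by
    cases l with
    | nil => exact absurd rfl hx
    | cons c l => exact ⟨c.1⟩
  have hs : FreeGroup.mk [(s, true), (s, false)] = 1 := mul_inv_cancel (FreeGroup.of s)
  have hsign : ((([(s, true), (s, false)] : List (S × Bool))).map (letterSign k)).prod = -1 := by
    simp [letterSign]
  have hl : (l.map (letterSign k)).prod = 1 ∨ (l.map (letterSign k)).prod = -1 := by
    clear hx
    induction l with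
    | nil => exact Or.inl rfl
    | cons c l ih =>
      rw [List.map_cons, List.prod_cons]
      rcases ih with ih | ih <;> rw [ih] <;> rcases c with ⟨s, _ | _⟩ <;> simp [letterSign]
  rcases hl with hl | hl
  · refine ⟨l ++ [(s, true), (s, false)], ?_, ?_, ?_⟩
    · rw [← FreeGroup.mul_mk, hs, mul_one]
    · simp
    · rw [List.map_append, List.prod_append, hl, hsign, one_mul]
  -- The sign is already right; the doubled padding preserves it and guarantees length at least two.
  · refine ⟨l ++ ([(s, true), (s, false)] ++ [(s, true), (s, false)]), ?_, ?_, ?_⟩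
    · rw [← FreeGroup.mul_mk, ← FreeGroup.mul_mk, hs, mul_one, mul_one]
    · simp
    · rw [List.map_append, List.prod_append, List.map_append, List.prod_append, hl, hsign]
      ring

/-- Every finitely presented group has a presentation by lassos and cross-lassos. -/
theorem exists_presentedGroup_equiv (k : Type u) [Field k] {S : Type*} [Finite S]
    (R : Set (FreeGroup S)) (hR : R.Finite) :
    ∃ (n : ℕ) (L : LassoData n), L.CrossesSeparated ∧ (∃ μ : Fin n → k, L.IsCharacter μ) ∧
      Nonempty (PresentedGroup L.relators ≃* PresentedGroup R) := by
  classical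
  obtain ⟨m, ⟨e⟩⟩ := Finite.exists_equiv_fin S
  -- Trivial relators get no block; they impose nothing on the group.
  have hfin : Finite {x : FreeGroup S // x ∈ R ∧ x ≠ 1} := (hR.subset fun x hx => hx.1).to_subtype
  obtain ⟨r, ⟨e'⟩⟩ := Finite.exists_equiv_fin {x : FreeGroup S // x ∈ R ∧ x ≠ 1}
  choose W hW hWlen hWsign using fun j : Fin r => exists_word k (e'.symm j).1 (e'.symm j).2.2
  -- The lexicographic sum places all source blocks before the relator blocks, so that crosses point
  -- from smaller to larger indices.
  let B : Lex (Fin m ⊕ Fin r) → List (S × Bool) := fun b =>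
    Sum.elim (fun i => [(e.symm i, true), (e.symm i, false)]) W (ofLex b)
  let src : Lex (Fin m ⊕ Fin r) → Prop := fun b => (ofLex b).isLeft = true
  have hsrc : ∀ b b', src b → ¬ src b' → b < b' := by
    rintro (i | j) (i' | j') h h'
    · exact absurd rfl h'
    · exact Sum.Lex.inl_lt_inr _ _
    · exact absurd h Bool.false_ne_true
    · exact absurd h Bool.false_ne_true
  have hlen : ∀ b, 2 ≤ lens B b := by
    rintro (i | j)
    · exact le_rfl
    · exact hWlen j
  refine ⟨_, ofWords B src hsrc hlen, crossesSeparated_ofWords, exists_isCharacter_ofWords ?_ ?_,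
    nonempty_equiv_ofWords R (fun s => toLex (Sum.inl (e s))) ?_ ?_ ?_ ?_ ?_⟩
  · rintro (i | j) h
    · change (List.map _ [(e.symm i, true), (e.symm i, false)]).prod = -1
      -- In a source block the negated signs are $1$ for $s$ and $-1$ for $s^{-1}$.
      simp [letterSign]
    · exact absurd h Bool.false_ne_true
  · rintro (i | j) h
    · exact absurd rfl h
    · exact hWsign j
  · exact fun s => rfl
  · rintro (i | j) h
    · exact ⟨e.symm i, by rw [e.apply_symm_apply]; rfl⟩
    · exact absurd h Bool.false_ne_true
  · intro s
    change [(e.symm (e s), true), (e.symm (e s), false)] = _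
    rw [e.symm_apply_apply]
  · rintro (i | j) h
    · exact absurd rfl h
    · change FreeGroup.mk (W j) ∈ R
      rw [hW]
      exact (e'.symm j).2.1
  · intro x hx
    by_cases hx1 : x = 1
    · exact Or.inl hx1
    · refine Or.inr ⟨toLex (Sum.inr (e' ⟨x, hx, hx1⟩)), Bool.false_ne_true, ?_⟩
      change FreeGroup.mk (W _) = x
      rw [hW, e'.symm_apply_apply]

end LassoData

/-! ### The theorem -/

theorem mainTheorem2 {k : Type u} [Field k] {H : Type*} [Group H]
    {S : Type*} [Finite S] [DecidableEq S] (R : Set (FreeGroup S)) (hR : R.Finite)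
    (hfree : ∀ s : S, ¬ IsFreeGenerator R s) (hH : Nonempty (H ≃* PresentedGroup R)) :
    ∃ (n : ℕ) (L : LassoData n)
      (φ : Fin n → (PathAlgebra k (ChainVertex n) ≃ₐ[k] PathAlgebra k (ChainVertex n)))
      (Ibar : TwoSidedIdeal (PathAlgebra k (ChainVertex n))),
      Nonempty (PresentedGroup L.relators ≃* H) ∧
      (∀ i, IsTransvection (φ i) (Chain.arrowA i) 1 (Chain.pathA i)) ∧
      (Ibar : Set (PathAlgebra k (ChainVertex n))) =
        (List.ofFn φ).reverse.prod '' (L.ideal k : Set (PathAlgebra k (ChainVertex n))) ∧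
      IsAcyclicQuiver (ChainVertex n) ∧
      (∃ (A : Type u) (_ : Ring A) (_ : Algebra k A),
        IsTriangularAlgebra k A ∧ IsPresentation (L.ideal k) A ∧ IsPresentation Ibar A) ∧
      (∀ v : ChainVertex n, Nonempty (FundamentalGroupBQ (L.ideal k) v ≃* H)) ∧
      (∀ v : ChainVertex n, Subsingleton (FundamentalGroupBQ Ibar v)) := by
  obtain ⟨e⟩ := hH
  obtain ⟨n, L, hL, ⟨μ, hμ⟩, ⟨e'⟩⟩ := LassoData.exists_presentedGroup_equiv k R hR
  refine ⟨n, L, Chain.transvection k, L.sheared k, ⟨e'.trans e.symm⟩, Chain.isTransvection k,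
    L.coe_sheared k, Chain.isAcyclicQuiver, L.exists_presentations k, fun v => ?_,
    LassoData.subsingleton_fundamentalGroup_sheared k hL⟩
  obtain ⟨e''⟩ := L.nonempty_fundamentalGroup_equiv hμ v
  exact ⟨e''.trans (e'.trans e.symm)⟩
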